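/- Let $\Omega \subset \mathbb{R}^d$ be a bounded, Lebesgue measurable set of positive Lebesgue measure $m(\Omega)$. A *spectrum* for $\Omega$ is a countable set $\Lambda\subset\mathbb{R}^d$ such that the system of exponentials $e_\lambda(x)=e^{2\pi i\langle\lambda,x\rangle}$, $\lambda\in\Lambda$, is orthogonal and complete in $L^2(\Omega)$; $\Omega$ is *spectral* if it has a spectrum. Write $\hat f(t)=\int f(x)e^{-2\pi i\langle t,x\rangle}\,dx$, and $$\mathcal{Z}(\hat{1}_\Omega)=\{t\in\mathbb{R}^d:\hat{1}_\Omega(t)=0\},\qquad \Delta(\Omega)=\{x\in\mathbb{R}^d: m(\Omega\cap(\Omega+x))>0\}.$$ A positive Borel measure $\mu$ on $\mathbb{R}^d$ is *translation-bounded* if $\sup_{x}\mu(B+x)<\infty$ for every open ball $B$. The Fourier transform $\hat\mu$ of such a measure is taken in the sense of tempered distributions, $\langle\hat\mu,\varphi\rangle=\langle\mu,\hat\varphi\rangle$ for every Schwartz function $\varphi$. A measure $\gamma$ is an *autocorrelation* of $\Lambda$ if there are $r_n\to\infty$ such that, with $\Lambda_r=\{\lambda\in\Lambda:|\lambda|<r\}$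 and $\delta_S=\sum_{s\in S}\delta_s$, the measures $|\Lambda_{r_n}|^{-1}\,\delta_{\Lambda_{r_n}}*\delta_{-\Lambda_{r_n}}$ converge to $\gamma$ vaguely (tested against continuous, compactly supported functions). **Theorem.** If $\Omega$ is spectral, then there exists a measure $\gamma$ on $\mathbb{R}^d$, which is an autocorrelation of some spectrum of $\Omega$, with the following properties: (a) $\gamma$ is a positive, translation-bounded measure; (b) the closed support of $\gamma$ is contained in $\mathcal{Z}(\hat{1}_\Omega)\cup\{0\}$; (c) $\gamma=\delta_0$ in some open neighborhood of the origin; (d) $\hat\gamma$ is also a positive, translation-bounded measure; (e) $\hat\gamma=m(\Omega)\,\delta_0$ in the set $\Delta(\Omega)$. -/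

import Mathlib

open MeasureTheory Filter Topology FourierTransform
open scoped ENNReal SchwartzMap

namespace Fuglede

noncomputable section

/-- Euclidean space `ℝ^d`, with its Euclidean norm, inner product and Lebesgue measure. -/
abbrev Rd (d : ℕ) : Type := EuclideanSpace ℝ (Fin d)

/-- The exponential function `e_lam(x) = exp(2πi⟨lam, x⟩)`. -/
def expFun {d : ℕ} (lam x : Rd d) : ℂ :=
  Complex.exp (2 * Real.pi * Complex.I * ((inner ℝ lam x : ℝ) : ℂ))

theorem continuous_expFun {d : ℕ} (lam : Rd d) : Continuous (expFun lam) := by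
  unfold expFun
  fun_prop

theorem norm_expFun {d : ℕ} (lam x : Rd d) : ‖expFun lam x‖ = 1 := by
  have h : (2 * Real.pi * Complex.I * ((inner ℝ lam x : ℝ) : ℂ) : ℂ)
      = ((2 * Real.pi * inner ℝ lam x : ℝ) : ℂ) * Complex.I := by
    push_cast
    ring
  rw [expFun, h, Complex.norm_exp_ofReal_mul_I]

theorem memLp_expFun {d : ℕ} {Ω : Set (Rd d)} (hΩ : Bornology.IsBounded Ω) (lam : Rd d) :
    MemLp (expFun lam) 2 (volume.restrict Ω) := by
  have : IsFiniteMeasure (volume.restrict Ω) :=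
    ⟨by rw [Measure.restrict_apply_univ]; exact hΩ.measure_lt_top⟩
  exact MemLp.of_bound (continuous_expFun lam).aestronglyMeasurable 1
    (Eventually.of_forall fun x => (norm_expFun lam x).le)

/-- The exponential `e_lam` as an element of the Hilbert space `L²(Ω)`, for a bounded set `Ω`. -/
def expL2 {d : ℕ} {Ω : Set (Rd d)} (hΩ : Bornology.IsBounded Ω) (lam : Rd d) :
    Lp ℂ 2 (volume.restrict Ω) :=
  (memLp_expFun hΩ lam).toLp (expFun lam)

/-- `Λ` is a spectrum for the bounded set `Ω`: it is a countable set and the system of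
exponentials `e_lam`, `lam ∈ Λ`, is orthogonal and complete in `L²(Ω)`. -/
structure IsSpectrum {d : ℕ} {Ω : Set (Rd d)} (hΩ : Bornology.IsBounded Ω) (Λ : Set (Rd d)) :
    Prop where
  countable : Λ.Countable
  orthogonal : ∀ lam ∈ Λ, ∀ lam' ∈ Λ, lam ≠ lam' → inner ℂ (expL2 hΩ lam) (expL2 hΩ lam') = 0
  complete : (Submodule.span ℂ (expL2 hΩ '' Λ)).topologicalClosure = ⊤

/-- A bounded set `Ω` is spectral if it has a spectrum. -/
def IsSpectral {d : ℕ} {Ω : Set (Rd d)} (hΩ : Bornology.IsBounded Ω) : Prop :=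
  ∃ Λ : Set (Rd d), IsSpectrum hΩ Λ

/-- The zero set of the Fourier transform `t ↦ ∫_Ω exp(-2πi⟨t, x⟩) dx` of the indicator
function of `Ω`. -/
def zeroSet {d : ℕ} (Ω : Set (Rd d)) : Set (Rd d) :=
  {t | 𝓕 (Ω.indicator fun _ => (1 : ℂ)) t = 0}

/-- `Δ(Ω)`, the set of all `x` such that `Ω ∩ (Ω + x)` has positive Lebesgue measure. -/
def Delta {d : ℕ} (Ω : Set (Rd d)) : Set (Rd d) :=
  {x | 0 < volume (Ω ∩ (fun y => y + x) '' Ω)}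

/-- A positive Borel measure is translation-bounded if, for every radius `r`, the masses of the
open balls of radius `r` are bounded by a finite constant. -/
def TranslationBounded {d : ℕ} (μ : Measure (Rd d)) : Prop :=
  ∀ r : ℝ, (⨆ x : Rd d, μ (Metric.ball x r)) < ∞

/-- `ν` is the Fourier transform of `μ`: both measures are tempered distributions, and
`⟨ν, φ⟩ = ⟨μ, 𝓕 φ⟩` for every Schwartz function `φ`. -/
def HasFourierTransform {d : ℕ} (μ ν : Measure (Rd d)) : Prop :=
  ∃ (_ : μ.HasTemperateGrowth) (_ : ν.HasTemperateGrowth),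
    𝓕 (μ.toTemperedDistribution : 𝓢'(Rd d, ℂ)) = (ν.toTemperedDistribution : 𝓢'(Rd d, ℂ))

/-- `δ_S`, the sum of the unit masses at the points of `S`. -/
def deltaSum {d : ℕ} (S : Set (Rd d)) : Measure (Rd d) :=
  Measure.sum fun s : S => Measure.dirac (s : Rd d)

/-- `|Λ_r|⁻¹ δ_{Λ_r} ∗ δ_{-Λ_r}`, where `Λ_r` is the part of `Λ` in the open ball of radius `r`
centred at the origin. -/
def averagedAutocorrelation {d : ℕ} (Λ : Set (Rd d)) (r : ℝ) : Measure (Rd d) :=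
  ((Λ ∩ Metric.ball 0 r).encard : ℝ≥0∞)⁻¹ •
    (deltaSum (Λ ∩ Metric.ball 0 r)).conv (deltaSum (-(Λ ∩ Metric.ball 0 r)))

/-- `γ` is an autocorrelation measure of `Λ`: it is the vague limit of the measures
`|Λ_r|⁻¹ δ_{Λ_r} ∗ δ_{-Λ_r}` along some sequence of radii tending to infinity. -/
def IsAutocorrelation {d : ℕ} (Λ : Set (Rd d)) (γ : Measure (Rd d)) : Prop :=
  ∃ r : ℕ → ℝ, Tendsto r atTop atTop ∧
    ∀ φ : Rd d → ℝ, Continuous φ → HasCompactSupport φ →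
      Tendsto (fun n => ∫ x, φ x ∂(averagedAutocorrelation Λ (r n))) atTop (𝓝 (∫ x, φ x ∂γ))

end

end Fuglede

/-! Let S run over the finite sets Λ ∩ B(0, r) of a spectrum Λ. The Fourier transform of |S|⁻¹ δ_S ∗
δ_{-S} is the nonnegative density |S|⁻¹ |∑ e_s|² (`integral_fourier_autoMeasure`), and orthogonality
controls both sides uniformly. The transform of 1_Ω is continuous and nonzero at 0, so Λ is
uniformly separated, which bounds the first measures on small balls. Integrated over a translate of
Ω, the second loses its off-diagonal terms and has mass at most m(Ω) (`powerMeasure_translate_le`).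
Weak compactness against polynomially decaying functions (`exists_subseq_tendsto_integral`) gives
limits γ and ν along a common subsequence. Schwartz functions are admissible tests, so ν is the
Fourier transform of γ. The support of γ and its form near 0 are inherited because an open set null
for all approximants is null for the limit.

Only the behaviour on Δ(Ω) needs completeness. The function w = 1_Ω ∗ 1_{-Ω} (`overlap`) is positive
exactly on Δ(Ω), and its transform is the square modulus of that of 1_Ω. By Parseval, the sum of
this square modulus over any translate of Λ is m(Ω)². Hence the integral of w(x)(1 - cos 2π⟨u,x⟩)
against the density equals the average over t ∈ S of the Parseval terms with s ∈ Λ \ S. Integrated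
over small u, this is an L² tail for t deep inside S and bounded for the remaining t, whose share is
negligible for suitable radii (`exists_radii`). In the limit, ∫ w(1 - cos) dν = 0 for a.e. small u,
so ν lives at 0 within {w > 0}. Finally ∫ w dν = m(Ω)² fixes the mass of that atom. -/

namespace Fuglede

/-! ### Polynomially decaying weights. -/

section Decay

variable {E : Type*} [NormedAddCommGroup E] [NormedSpace ℝ E]

variable (E) in
/-- An integrable weight of polynomial decay. -/
noncomputable def decay (x : E) : ℝ := (1 + ‖x‖) ^ (-((Module.finrank ℝ E + 1 : ℕ) : ℝ))

theorem decay_pos (x : E) : 0 < decay E x := by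
  unfold decay; positivity

theorem continuous_decay : Continuous (decay E) := by
  unfold decay
  refine Continuous.rpow_const (by fun_prop) fun x => Or.inl ?_
  positivity

/-- The weight varies slowly because 1 + ‖y‖ ≤ (1 + R)(1 + ‖x‖). Averaging it over a bounded set
therefore costs only a constant. -/
theorem decay_le_mul {R : ℝ} {x y : E} (h : ‖x - y‖ ≤ R) :
    decay E x ≤ (1 + R) ^ (Module.finrank ℝ E + 1) * decay E y := by
  have hR : 0 ≤ R := (norm_nonneg _).trans h
  have hy : ‖y‖ ≤ ‖x‖ + R := by
    calc ‖y‖ = ‖x - (x - y)‖ := by congr 1; abel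
      _ ≤ ‖x‖ + ‖x - y‖ := norm_sub_le _ _
      _ ≤ ‖x‖ + R := by linarith
  have hxp : 0 < 1 + ‖x‖ := by positivity
  have hyp : 0 < 1 + ‖y‖ := by positivity
  unfold decay
  rw [Real.rpow_neg hxp.le, Real.rpow_neg hyp.le, Real.rpow_natCast, Real.rpow_natCast,
    ← div_eq_mul_inv, le_div_iff₀ (by positivity), ← div_eq_inv_mul, div_le_iff₀ (by positivity),
    ← mul_pow]
  gcongr
  nlinarith [norm_nonneg x]

theorem exists_norm_le_mul_decay_schwartz (f : 𝓢(E, ℂ)) : ∃ K, ∀ x, ‖f x‖ ≤ K * decay E x := by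
  obtain ⟨C, hC⟩ : ∃ C, ∀ x, (1 + ‖x‖) ^ (Module.finrank ℝ E + 1) * ‖f x‖ ≤ C := by
    have := SchwartzMap.one_add_le_sup_seminorm_apply (𝕜 := ℝ)
      (m := (Module.finrank ℝ E + 1, 0)) le_rfl le_rfl f
    exact ⟨_, fun x => by simpa using this x⟩
  refine ⟨C, fun x => ?_⟩
  rw [decay, Real.rpow_neg (by positivity), Real.rpow_natCast, ← div_eq_mul_inv,
    le_div_iff₀ (by positivity), mul_comm]
  exact hC x

theorem exists_norm_le_mul_decay {F : Type*} [NormedAddCommGroup F] {f : E → F} (hf : Continuous f)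
    (hc : HasCompactSupport f) : ∃ K, ∀ x, ‖f x‖ ≤ K * decay E x := by
  have h1 : Continuous fun x => (decay E x)⁻¹ • ‖f x‖ :=
    (continuous_decay.inv₀ fun x => (decay_pos x).ne').smul hf.norm
  have h2 : HasCompactSupport fun x => (decay E x)⁻¹ • ‖f x‖ :=
    HasCompactSupport.smul_left (f := fun x => (decay E x)⁻¹) hc.norm
  obtain ⟨K, hK⟩ := h1.bounded_above_of_compact_support h2
  refine ⟨K, fun x => ?_⟩
  have := (le_abs_self _).trans (hK x)
  rwa [smul_eq_mul, inv_mul_le_iff₀ (decay_pos x), mul_comm] at this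

end Decay

/-! ### Uniform translation bounds and weak compactness. -/

section TranslationBounds

variable {E : Type*} [NormedAddCommGroup E] [NormedSpace ℝ E] [FiniteDimensional ℝ E]
  [MeasurableSpace E] [BorelSpace E]

/-- If all translates of `A` have `μ`-mass at most `C`, then integrals against `μ` are controlled
by Lebesgue integrals of a majorant. -/
theorem measure_mul_lintegral_le (vol : Measure E) [vol.IsAddHaarMeasure] {μ : Measure E}
    [SFinite μ] {A : Set E} (hA : MeasurableSet A) {C : ℝ≥0∞} (hC : C ≠ ∞)
    (hμ : ∀ y, μ ((fun x => x - y) ⁻¹' A) ≤ C) {g G : E → ℝ≥0∞} (hg : Measurable g)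
    (hgG : ∀ x y, x - y ∈ A → g x ≤ G y) :
    vol A * ∫⁻ x, g x ∂μ ≤ C * ∫⁻ y, G y ∂vol := by
  have hmeas : Measurable (Function.uncurry fun x y : E => A.indicator 1 (x - y) * g x) :=
    ((measurable_one.indicator hA).comp (measurable_fst.sub measurable_snd)).mul
      (hg.comp measurable_fst)
  have hvol (x : E) : ∫⁻ y, A.indicator (1 : E → ℝ≥0∞) (x - y) ∂vol = vol A := by
    rw [lintegral_sub_left_eq_self (fun y => A.indicator (1 : E → ℝ≥0∞) y) x,
      lintegral_indicator_one hA]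
  -- Tonelli for 1_A(x - y) g(x): integrating in y first gives `vol A`, while integrating in x first
  -- only sees the mass of a translate of A.
  calc vol A * ∫⁻ x, g x ∂μ = ∫⁻ x, ∫⁻ y, A.indicator 1 (x - y) * g x ∂vol ∂μ := by
        rw [← lintegral_const_mul _ hg]
        refine lintegral_congr fun x => ?_
        have hm : Measurable fun y => A.indicator (1 : E → ℝ≥0∞) (x - y) :=
          (measurable_one.indicator hA).comp (measurable_const.sub measurable_id)
        rw [lintegral_mul_const _ hm, hvol]
    _ = ∫⁻ y, ∫⁻ x, A.indicator 1 (x - y) * g x ∂μ ∂vol :=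
        lintegral_lintegral_swap hmeas.aemeasurable
    _ ≤ ∫⁻ y, C * G y ∂vol := by
        refine lintegral_mono fun y => ?_
        have hAy : MeasurableSet ((fun x => x - y) ⁻¹' A) := (measurable_id.sub_const y) hA
        calc ∫⁻ x, A.indicator 1 (x - y) * g x ∂μ
            ≤ ∫⁻ x, ((fun x => x - y) ⁻¹' A).indicator (fun _ => G y) x ∂μ := by
              refine lintegral_mono fun x => ?_
              by_cases h : x - y ∈ A
              · simpa [Set.indicator, h] using hgG x y h
              · simp [Set.indicator, h]
          _ = G y * μ ((fun x => x - y) ⁻¹' A) := by rw [lintegral_indicator_const hAy]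
          _ ≤ C * G y := by rw [mul_comm]; gcongr; exact hμ y
    _ = C * ∫⁻ y, G y ∂vol := lintegral_const_mul' _ _ hC

theorem measure_mul_ball_le (vol : Measure E) [vol.IsAddHaarMeasure] {μ : Measure E}
    [SFinite μ] {A : Set E} (hA : MeasurableSet A) {R : ℝ} (hAR : A ⊆ Metric.closedBall 0 R)
    {C : ℝ≥0∞} (hC : C ≠ ∞) (hμ : ∀ y, μ ((fun x => x - y) ⁻¹' A) ≤ C) (x : E) (r : ℝ) :
    vol A * μ (Metric.ball x r) ≤ C * vol (Metric.ball 0 (r + R)) := by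
  have := measure_mul_lintegral_le vol hA hC hμ
    (g := (Metric.ball x r).indicator 1) (G := (Metric.ball x (r + R)).indicator 1)
    (measurable_one.indicator measurableSet_ball) ?_
  · rwa [lintegral_indicator_one measurableSet_ball, lintegral_indicator_one measurableSet_ball,
      Measure.addHaar_ball_center vol] at this
  · intro z y hzy
    by_cases hz : z ∈ Metric.ball x r
    · have h1 : ‖z - y‖ ≤ R := by simpa using hAR hzy
      have hy : y ∈ Metric.ball x (r + R) := by
        rw [Metric.mem_ball] at hz ⊢
        calc dist y x ≤ dist y z + dist z x := dist_triangle _ _ _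
          _ < r + R := by rw [dist_comm y z, dist_eq_norm z y]; linarith
      simp [hz, hy]
    · simp [hz]

theorem integrable_decay (vol : Measure E) [vol.IsAddHaarMeasure] : Integrable (decay E) vol :=
  integrable_one_add_norm (by push_cast; linarith)

/-- Weak compactness: measures whose masses on translates of a fixed set are uniformly bounded
have a subsequence converging against all continuous functions dominated by `decay`. -/
theorem exists_subseq_tendsto_integral (vol : Measure E) [vol.IsAddHaarMeasure]
    (μ : ℕ → Measure E) [∀ n, SFinite (μ n)] {A : Set E} (hA : MeasurableSet A) (hA0 : vol A ≠ 0)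
    {R : ℝ} (hAR : A ⊆ Metric.closedBall 0 R) {C : ℝ≥0∞} (hC : C ≠ ∞)
    (hμ : ∀ n y, μ n ((fun x => x - y) ⁻¹' A) ≤ C) :
    (∀ n, Integrable (decay E) (μ n)) ∧
    ∃ σ : ℕ → ℕ, StrictMono σ ∧ ∃ μ' : Measure E, IsLocallyFiniteMeasure μ' ∧ SFinite μ' ∧
      Integrable (decay E) μ' ∧
      ∀ f : E → ℝ, Continuous f → (∃ K, ∀ x, |f x| ≤ K * decay E x) →
        Tendsto (fun n => ∫ x, f x ∂(μ (σ n))) atTop (𝓝 (∫ x, f x ∂μ')) := by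
  have hR : 0 ≤ R := by
    obtain ⟨x, hx⟩ := nonempty_of_measure_ne_zero hA0
    exact (norm_nonneg x).trans (by simpa using hAR hx)
  have hAtop : vol A ≠ ∞ := ((Metric.isBounded_closedBall.subset hAR).measure_lt_top).ne
  set w : E → ℝ≥0∞ := fun x => ENNReal.ofReal (decay E x) with hw
  have hwm : Measurable w := continuous_decay.measurable.ennreal_ofReal
  set L : ℝ≥0∞ := ENNReal.ofReal ((1 + R) ^ (Module.finrank ℝ E + 1)) with hL
  have hwL (x y : E) (h : ‖x - y‖ ≤ R) : w x ≤ L * w y := by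
    rw [hw, hL]
    dsimp only
    rw [← ENNReal.ofReal_mul (by positivity)]
    exact ENNReal.ofReal_le_ofReal (decay_le_mul h)
  set D : Measure E := vol.withDensity w with hD
  have hDfin : IsFiniteMeasure D :=
    isFiniteMeasure_withDensity_ofReal (integrable_decay vol).2
  set B : ℝ≥0∞ := (vol A)⁻¹ * (C * L) with hB
  have hBtop : B ≠ ∞ := by
    rw [hB]
    exact ENNReal.mul_ne_top (ENNReal.inv_ne_top.2 hA0) (ENNReal.mul_ne_top hC (by simp [hL]))
  -- After weighting, every μ n is dominated by one fixed finite measure D, up to enlarging the set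
  -- by R. This gives both bounded mass and tightness.
  have key (n : ℕ) (S T : Set E) (hS : MeasurableSet S) (hT : MeasurableSet T)
      (hST : ∀ x ∈ S, ∀ y, ‖x - y‖ ≤ R → y ∈ T) :
      (μ n).withDensity w S ≤ B * D T := by
    have h1 := measure_mul_lintegral_le vol hA hC (hμ n) (g := S.indicator w)
      (G := fun y => L * T.indicator w y) (hwm.indicator hS) (fun x y hxy => by
        have hxy' : ‖x - y‖ ≤ R := by simpa using hAR hxy
        by_cases hx : x ∈ S
        · simpa [hx, hST x hx y hxy'] using hwL x y hxy'
        · simp [hx])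
    rw [lintegral_const_mul' _ _ (by simp [hL]), lintegral_indicator hS, lintegral_indicator hT,
      ← withDensity_apply _ hS, ← withDensity_apply _ hT, ← mul_assoc] at h1
    rw [hB, mul_assoc, mul_comm (vol A)⁻¹, ← div_eq_mul_inv, ENNReal.le_div_iff_mul_le
      (Or.inl hA0) (Or.inl hAtop), mul_comm]
    exact h1
  have hmass (n : ℕ) : (μ n).withDensity w Set.univ ≤ B * D Set.univ :=
    key n _ _ .univ .univ fun _ _ _ _ => trivial
  have hfin (n : ℕ) : IsFiniteMeasure ((μ n).withDensity w) :=
    ⟨(hmass n).trans_lt (ENNReal.mul_lt_top hBtop.lt_top (measure_lt_top _ _))⟩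
  refine ⟨fun n => ⟨continuous_decay.aestronglyMeasurable, ?_⟩, ?_⟩
  · rw [hasFiniteIntegral_iff_ofReal (ae_of_all _ fun x => (decay_pos x).le),
      ← setLIntegral_univ, ← withDensity_apply _ .univ]
    exact measure_lt_top _ _
  let F (n : ℕ) : FiniteMeasure E := ⟨(μ n).withDensity w, hfin n⟩
  obtain ⟨σ, hσ, F', hF'⟩ : ∃ σ : ℕ → ℕ, StrictMono σ ∧ ∃ F' : FiniteMeasure E,
      Tendsto (fun n => F (σ n)) atTop (𝓝 F') := by
    set M : NNReal := (B * D Set.univ).toNNReal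
    have hM : ∀ n, (F n).mass ∈ Set.Icc 0 M := fun n => by
      refine ⟨zero_le, ?_⟩
      rw [← ENNReal.coe_le_coe, FiniteMeasure.ennreal_mass,
        ENNReal.coe_toNNReal (ENNReal.mul_ne_top hBtop (measure_ne_top _ _))]
      exact hmass n
    obtain ⟨m, -, σ₁, hσ₁, hm⟩ := isCompact_Icc.tendsto_subseq hM
    -- Prokhorov's theorem is used for probability measures, so masses are normalized; a vanishing
    -- limit mass is treated apart.
    rcases eq_or_ne m 0 with rfl | hm0
    · exact ⟨σ₁, hσ₁, 0, FiniteMeasure.tendsto_zero_of_tendsto_zero_mass hm⟩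
    -- From n₀ on, the masses exceed m / 2, so normalizing costs at most the factor 2 / m.
    obtain ⟨n₀, hn₀⟩ := eventually_atTop.1
      (hm.eventually (lt_mem_nhds (half_lt_self (pos_iff_ne_zero.2 hm0))))
    have hne (n : ℕ) : F (σ₁ (n + n₀)) ≠ 0 := by
      rw [← FiniteMeasure.mass_nonzero_iff]
      exact (zero_le.trans_lt (hn₀ (n + n₀) (by omega))).ne'
    let P (n : ℕ) : ProbabilityMeasure E := (F (σ₁ (n + n₀))).normalize
    have htight : IsTightMeasureSet {((μ : ProbabilityMeasure E) : Measure E) | μ ∈ Set.range P} := by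
      rw [isTightMeasureSet_iff_exists_isCompact_measure_compl_le]
      intro ε hε
      set c : ℝ≥0∞ := ((m / 2 : NNReal) : ℝ≥0∞)⁻¹ * B with hc
      have hm2 : ((m / 2 : NNReal) : ℝ≥0∞) ≠ 0 := by
        rw [ENNReal.coe_ne_zero]; positivity
      have hctop : c ≠ ∞ := ENNReal.mul_ne_top (ENNReal.inv_ne_top.2 hm2) hBtop
      obtain ⟨δ, hδ, hδε⟩ : ∃ δ : ℝ≥0∞, 0 < δ ∧ c * δ ≤ ε := by
        rcases eq_or_ne ε ∞ with rfl | hεt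
        · exact ⟨1, one_pos, le_top⟩
        · refine ⟨ε / (c + 1), ENNReal.div_pos hε.ne' (by simp [hctop]), ?_⟩
          calc c * (ε / (c + 1)) ≤ (c + 1) * (ε / (c + 1)) := by gcongr; exact le_self_add
            _ ≤ ε := ENNReal.mul_div_le
      obtain ⟨K, hK, hDK⟩ := isTightMeasureSet_iff_exists_isCompact_measure_compl_le.1
        (isTightMeasureSet_singleton (μ := D)) δ hδ
      obtain ⟨ρ, hρ⟩ := hK.isBounded.subset_closedBall 0
      have := FiniteDimensional.proper_real E
      refine ⟨Metric.closedBall 0 (ρ + R), isCompact_closedBall _ _, ?_⟩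
      rintro _ ⟨_, ⟨n, rfl⟩, rfl⟩
      have h1 := key (σ₁ (n + n₀)) (Metric.closedBall 0 (ρ + R))ᶜ (Metric.closedBall 0 ρ)ᶜ
        measurableSet_closedBall.compl measurableSet_closedBall.compl (fun x hx y hxy => by
          simp only [Set.mem_compl_iff, mem_closedBall_zero_iff, not_le] at hx ⊢
          have : ‖x‖ ≤ ‖x - y‖ + ‖y‖ := by simpa using norm_add_le (x - y) y
          linarith)
      have h2 : D (Metric.closedBall 0 ρ)ᶜ ≤ δ :=
        (measure_mono (Set.compl_subset_compl.2 hρ)).trans (hDK D rfl)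
      rw [FiniteMeasure.toMeasure_normalize_eq_of_nonzero _ (hne n), Measure.smul_apply]
      calc ((F (σ₁ (n + n₀))).mass⁻¹ : NNReal) • (μ (σ₁ (n + n₀))).withDensity w
              (Metric.closedBall 0 (ρ + R))ᶜ
          ≤ ((m / 2 : NNReal) : ℝ≥0∞)⁻¹ * (B * δ) := by
            rw [ENNReal.smul_def, smul_eq_mul,
              ENNReal.coe_inv ((FiniteMeasure.mass_nonzero_iff _).2 (hne n))]
            gcongr
            · exact (hn₀ (n + n₀) (by omega)).le
            · exact h1.trans (by gcongr)
        _ ≤ ε := by rwa [← mul_assoc]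
    obtain ⟨Q, -, σ₂, hσ₂, hQ⟩ := (isCompact_closure_of_isTightMeasureSet htight).isSeqCompact
      (fun n => subset_closure (Set.mem_range_self (f := P) n))
    refine ⟨fun n => σ₁ (σ₂ n + n₀), fun a b hab => hσ₁ (by have := hσ₂ hab; omega),
      m • Q.toFiniteMeasure, ?_⟩
    have hQm : (m • Q.toFiniteMeasure).mass = m := by
      rw [FiniteMeasure.mass, FiniteMeasure.coeFn_smul, Pi.smul_apply, ← FiniteMeasure.mass,
        ProbabilityMeasure.mass_toFiniteMeasure, smul_eq_mul, mul_one]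
    have hQ0 : m • Q.toFiniteMeasure ≠ 0 := by
      rw [← FiniteMeasure.mass_nonzero_iff, hQm]; exact hm0
    refine FiniteMeasure.tendsto_of_tendsto_normalize_testAgainstNN_of_tendsto_mass ?_ ?_
    · have : (m • Q.toFiniteMeasure).normalize = Q := by
        apply (ProbabilityMeasure.toFiniteMeasure_isEmbedding E).injective
        rw [FiniteMeasure.normalize_eq_inv_mass_smul_of_nonzero _ hQ0, hQm, smul_smul,
          inv_mul_cancel₀ hm0, one_smul]
      rw [this]
      exact hQ
    · rw [hQm]
      exact hm.comp ((tendsto_add_atTop_nat n₀).comp hσ₂.tendsto_atTop)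
  have hpos (x : E) : (ENNReal.ofReal (decay E x)⁻¹).toReal = (decay E x)⁻¹ :=
    ENNReal.toReal_ofReal (inv_nonneg.2 (decay_pos x).le)
  have hcinv : Continuous fun x : E => (decay E x)⁻¹ :=
    continuous_decay.inv₀ fun x => (decay_pos x).ne'
  have hminv : Measurable fun x : E => ENNReal.ofReal (decay E x)⁻¹ :=
    hcinv.measurable.ennreal_ofReal
  -- Dividing the limit by the weight undoes the weighting. A test function bounded by K times the
  -- weight becomes bounded and continuous after the same division.
  refine ⟨σ, hσ, (F' : Measure E).withDensity fun x => ENNReal.ofReal (decay E x)⁻¹,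
    IsLocallyFiniteMeasure.withDensity_ofReal hcinv, inferInstance, ?_, ?_⟩
  · rw [integrable_withDensity_iff_integrable_smul' hminv (ae_of_all _ fun x => by simp)]
    refine (integrable_const (1 : ℝ)).congr (ae_of_all _ fun x => ?_)
    simp [hpos, (decay_pos x).ne']
  · rintro f hf ⟨K, hK⟩
    let b : BoundedContinuousFunction E ℝ := BoundedContinuousFunction.ofNormedAddCommGroup
      (fun x => (decay E x)⁻¹ * f x) (hcinv.mul hf) K (fun x => by
        rw [Real.norm_eq_abs, abs_mul, abs_of_pos (inv_pos.2 (decay_pos x)),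
          inv_mul_le_iff₀ (decay_pos x), mul_comm]
        exact hK x)
    have h1 := FiniteMeasure.tendsto_iff_forall_integral_tendsto.1 hF' b
    have h2 : ∫ x, f x ∂((F' : Measure E).withDensity fun x => ENNReal.ofReal (decay E x)⁻¹) =
        ∫ x, b x ∂(F' : Measure E) := by
      rw [integral_withDensity_eq_integral_toReal_smul hminv (ae_of_all _ fun x => by simp)]
      exact integral_congr_ae (ae_of_all _ fun x => by simp [b, hpos])
    rw [h2]
    refine h1.congr fun n => ?_
    change ∫ x, b x ∂((μ (σ n)).withDensity w) = _
    rw [integral_withDensity_eq_integral_toReal_smul hwm (ae_of_all _ fun x => by simp [hw])]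
    refine integral_congr_ae (ae_of_all _ fun x => ?_)
    simp [b, hw, ENNReal.toReal_ofReal (decay_pos x).le, (decay_pos x).ne']

/-- Upper bounds on the masses of an open set persist in the limit. -/
theorem measure_le_of_tendsto_integral {μ : ℕ → Measure E} {μ' : Measure E}
    [IsLocallyFiniteMeasure μ']
    (h : ∀ f : E → ℝ, Continuous f → HasCompactSupport f →
        Tendsto (fun n => ∫ x, f x ∂(μ n)) atTop (𝓝 (∫ x, f x ∂μ')))
    {U : Set E} (hU : IsOpen U) {K : ℝ≥0∞} (hK : K ≠ ∞) (hμ : ∀ n, μ n U ≤ K) : μ' U ≤ K := by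
  have := FiniteDimensional.proper_real E
  rw [hU.measure_eq_iSup_isCompact]
  refine iSup₂_le fun S hSU => iSup_le fun hS => ?_
  obtain ⟨f, hf1, hf0, hfc, hf01⟩ := exists_continuous_one_zero_of_isCompact hS hU.isClosed_compl
    (Set.disjoint_compl_right_iff_subset.2 hSU)
  have h1 : ∫ x, f x ∂μ' ≤ K.toReal := by
    refine le_of_tendsto (h f f.continuous hfc) (Eventually.of_forall fun n => ?_)
    calc ∫ x, f x ∂(μ n) ≤ ∫ x, U.indicator 1 x ∂(μ n) := by
          refine integral_mono_of_nonneg (ae_of_all _ fun x => (hf01 x).1) ?_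
            (ae_of_all _ fun x => ?_)
          · exact (integrable_indicator_iff hU.measurableSet).2
              (integrableOn_const ((hμ n).trans_lt hK.lt_top).ne)
          · by_cases hx : x ∈ U
            · simpa [hx] using (hf01 x).2
            · simp [hx, hf0 hx]
      _ = (μ n).real U := by rw [integral_indicator_one hU.measurableSet]
      _ ≤ K.toReal := ENNReal.toReal_mono hK (hμ n)
  have hfi : Integrable f μ' := f.continuous.integrable_of_hasCompactSupport hfc
  calc μ' S = ∫⁻ x, S.indicator 1 x ∂μ' := (lintegral_indicator_one hS.measurableSet).symm
    _ ≤ ∫⁻ x, ENNReal.ofReal (f x) ∂μ' := by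
        refine lintegral_mono fun x => ?_
        by_cases hx : x ∈ S
        · simp [hx, hf1 hx]
        · simp [hx]
    _ = ENNReal.ofReal (∫ x, f x ∂μ') :=
        (ofReal_integral_eq_lintegral_ofReal hfi (ae_of_all _ fun x => (hf01 x).1)).symm
    _ ≤ K := ENNReal.ofReal_le_of_le_toReal h1

omit [FiniteDimensional ℝ E] in
theorem tendsto_integral_of_norm_le_decay {μ : ℕ → Measure E} {μ' : Measure E}
    (hi : ∀ n, Integrable (decay E) (μ n)) (hi' : Integrable (decay E) μ')
    (h : ∀ f : E → ℝ, Continuous f → (∃ K, ∀ x, |f x| ≤ K * decay E x) →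
        Tendsto (fun n => ∫ x, f x ∂(μ n)) atTop (𝓝 (∫ x, f x ∂μ')))
    {f : E → ℂ} (hf : Continuous f) (hK : ∃ K, ∀ x, ‖f x‖ ≤ K * decay E x) :
    Tendsto (fun n => ∫ x, f x ∂(μ n)) atTop (𝓝 (∫ x, f x ∂μ')) := by
  obtain ⟨K, hK⟩ := hK
  have hfi {ν : Measure E} (hν : Integrable (decay E) ν) : Integrable f ν :=
    (hν.const_mul K).mono' hf.aestronglyMeasurable (ae_of_all _ hK)
  have hre := h (fun x => (f x).re) (Complex.continuous_re.comp hf)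
    ⟨K, fun x => (Complex.abs_re_le_norm _).trans (hK x)⟩
  have him := h (fun x => (f x).im) (Complex.continuous_im.comp hf)
    ⟨K, fun x => (Complex.abs_im_le_norm _).trans (hK x)⟩
  have h1 := ((Complex.continuous_ofReal.tendsto _).comp hre).add
    (((Complex.continuous_ofReal.tendsto _).comp him).mul_const Complex.I)
  have h2 {ν : Measure E} (hν : Integrable (decay E) ν) :
      ((∫ x, (f x).re ∂ν : ℝ) : ℂ) + ((∫ x, (f x).im ∂ν : ℝ) : ℂ) * Complex.I = ∫ x, f x ∂ν :=
    integral_re_add_im (hfi hν)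
  rw [h2 hi'] at h1
  exact h1.congr fun n => h2 (hi n)

end TranslationBounds
-- Exponential integrals and the overlap function.
section Exponentials

variable {d : ℕ}

theorem expFun_eq_fourierChar (u x : Rd d) : expFun u x = (Real.fourierChar (inner ℝ u x) : ℂ) := by
  rw [Real.fourierChar_apply, expFun]
  congr 1
  push_cast
  ring

theorem expFun_zero_left (x : Rd d) : expFun 0 x = 1 := by simp [expFun]

theorem expFun_add_left (u v x : Rd d) : expFun (u + v) x = expFun u x * expFun v x := by
  simp only [expFun, inner_add_left, ← Complex.exp_add]
  push_cast
  ring_nf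

theorem expFun_add_right (u x y : Rd d) : expFun u (x + y) = expFun u x * expFun u y := by
  simp only [expFun, inner_add_right, ← Complex.exp_add]
  push_cast
  ring_nf

theorem expFun_neg_left (u x : Rd d) : expFun (-u) x = starRingEnd ℂ (expFun u x) := by
  simp only [expFun, ← Complex.exp_conj, inner_neg_left, map_mul, Complex.conj_ofReal,
    Complex.conj_I, map_ofNat]
  push_cast
  ring_nf

theorem expFun_sub_left (u v x : Rd d) :
    expFun (u - v) x = expFun u x * starRingEnd ℂ (expFun v x) := by
  rw [sub_eq_add_neg, expFun_add_left, expFun_neg_left]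

theorem expFun_re (u x : Rd d) : (expFun u x).re = Real.cos (2 * Real.pi * inner ℝ u x) := by
  have h : (2 * Real.pi * Complex.I * ((inner ℝ u x : ℝ) : ℂ) : ℂ)
      = ((2 * Real.pi * inner ℝ u x : ℝ) : ℂ) * Complex.I := by
    push_cast
    ring
  rw [expFun, h, Complex.exp_ofReal_mul_I_re]

/-- The integral of the exponential `e_u` over the set `A`. -/
noncomputable def expInt (A : Set (Rd d)) (u : Rd d) : ℂ := ∫ x in A, expFun u x

theorem expInt_congr {A B : Set (Rd d)} (h : A =ᵐ[volume] B) : expInt A = expInt B := by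
  ext u
  rw [expInt, expInt, Measure.restrict_congr_set h]

theorem expInt_zero (A : Set (Rd d)) : expInt A 0 = volume.real A := by
  simp [expInt, expFun_zero_left]

theorem expInt_neg (A : Set (Rd d)) (u : Rd d) : expInt A (-u) = starRingEnd ℂ (expInt A u) := by
  simp only [expInt, expFun_neg_left]
  exact integral_conj

theorem norm_expInt_neg (A : Set (Rd d)) (u : Rd d) : ‖expInt A (-u)‖ = ‖expInt A u‖ := by
  rw [expInt_neg, RCLike.norm_conj]

theorem fourier_indicator {A : Set (Rd d)} (hA : NullMeasurableSet A volume) (u : Rd d) :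
    𝓕 (A.indicator fun _ => (1 : ℂ)) u = expInt A (-u) := by
  rw [Real.fourier_eq, expInt, ← integral_indicator₀ hA]
  refine integral_congr_ae (ae_of_all _ fun x => ?_)
  by_cases hx : x ∈ A
  · simp [hx, Circle.smul_def, expFun_eq_fourierChar, real_inner_comm]
  · simp [hx]

variable {A : Set (Rd d)}

theorem integrable_indicator_one (hb : Bornology.IsBounded A) (hA : MeasurableSet A) :
    Integrable (A.indicator fun _ => (1 : ℂ)) (volume : Measure (Rd d)) :=
  (integrable_indicator_iff hA).2 (integrableOn_const hb.measure_lt_top.ne)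

theorem continuous_expInt (hb : Bornology.IsBounded A) : Continuous (expInt A) := by
  have : IsFiniteMeasure (volume.restrict A) :=
    ⟨by rw [Measure.restrict_apply_univ]; exact hb.measure_lt_top⟩
  refine continuous_of_dominated (bound := fun _ => 1)
    (fun u => (continuous_expFun u).aestronglyMeasurable)
    (fun u => ae_of_all _ fun x => (norm_expFun u x).le) (integrable_const _)
    (ae_of_all _ fun x => ?_)
  unfold expFun
  fun_prop

theorem norm_expInt_le (A : Set (Rd d)) (u : Rd d) : ‖expInt A u‖ ≤ volume.real A := by
  rw [expInt]
  refine (norm_integral_le_integral_norm _).trans ?_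
  simp [norm_expFun]

/-- The measure of the overlap `A ∩ (A + x)`. -/
noncomputable def overlap (A : Set (Rd d)) (x : Rd d) : ℝ :=
  volume.real (A ∩ (fun y => y - x) ⁻¹' A)

theorem overlap_nonneg (A : Set (Rd d)) (x : Rd d) : 0 ≤ overlap A x := measureReal_nonneg

theorem overlap_zero (A : Set (Rd d)) : overlap A 0 = volume.real A := by simp [overlap]

-- Translation is continuous in measure. This makes the overlap a legitimate vague test function.
open scoped symmDiff in
theorem continuous_overlap (hb : Bornology.IsBounded A) (hA : MeasurableSet A) :
    Continuous (overlap A) := by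
  have hfin : volume A ≠ ∞ := hb.measure_lt_top.ne
  rw [continuous_iff_continuousAt]
  intro x₀
  let τ : Rd d → C(Rd d, Rd d) := fun x => ⟨fun y => y - x, by fun_prop⟩
  have hτ : Continuous τ := ContinuousMap.continuous_of_continuous_uncurry _
    (by simp only [τ, ContinuousMap.coe_mk]; fun_prop)
  have h1 := tendsto_measure_symmDiff_preimage_nhds_zero (μ := volume) (ν := volume)
    (hτ.tendsto x₀) (Eventually.of_forall fun x => measurePreserving_sub_right volume x)
    (measurePreserving_sub_right volume x₀) hA.nullMeasurableSet hfin
  have h2 := (ENNReal.tendsto_toReal ENNReal.zero_ne_top).comp h1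
  rw [ContinuousAt, tendsto_iff_dist_tendsto_zero]
  refine squeeze_zero (fun _ => dist_nonneg) (fun x => ?_) h2
  have hx (x : Rd d) : volume (A ∩ (fun y => y - x) ⁻¹' A) ≠ ∞ :=
    ((measure_mono Set.inter_subset_left).trans_lt hfin.lt_top).ne
  have hm (x : Rd d) : MeasurableSet ((fun y => y - x) ⁻¹' A) := (measurable_id.sub_const x) hA
  have hp (x : Rd d) : volume ((fun y => y - x) ⁻¹' A) ≠ ∞ := by
    rw [(measurePreserving_sub_right volume x).measure_preimage hA.nullMeasurableSet]
    exact hfin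
  rw [Real.dist_eq, overlap, overlap]
  refine (abs_measureReal_sub_le_measureReal_symmDiff' (hA.inter (hm x)).nullMeasurableSet
    (hA.inter (hm x₀)).nullMeasurableSet (hx _) (hx _)).trans ?_
  refine ENNReal.toReal_mono ?_ (measure_mono ?_)
  · exact ((measure_mono Set.symmDiff_subset_union).trans_lt
      ((measure_union_le _ _).trans_lt (ENNReal.add_lt_top.2 ⟨(hp x).lt_top, (hp x₀).lt_top⟩))).ne
  · rw [← Set.inter_symmDiff_distrib_left]
    exact Set.inter_subset_right

theorem hasCompactSupport_overlap (hb : Bornology.IsBounded A) : HasCompactSupport (overlap A) := by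
  obtain ⟨R, hR⟩ := hb.subset_closedBall 0
  refine HasCompactSupport.intro (isCompact_closedBall (0 : Rd d) (R + R)) fun x hx => ?_
  have : A ∩ (fun y => y - x) ⁻¹' A = ∅ := by
    ext y
    simp only [Set.mem_inter_iff, Set.mem_preimage, Set.mem_empty_iff_false, iff_false, not_and]
    intro hy hyx
    apply hx
    have h1 : ‖y‖ ≤ R := by simpa using hR hy
    have h2 : ‖y - x‖ ≤ R := by simpa using hR hyx
    rw [mem_closedBall_zero_iff]
    calc ‖x‖ = ‖y - (y - x)‖ := by congr 1; abel
      _ ≤ R + R := (norm_sub_le _ _).trans (add_le_add h1 h2)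
  rw [overlap, this, measureReal_empty]

theorem overlap_eq_convolution (hA : MeasurableSet A) (x : Rd d) :
    (overlap A x : ℂ) = (convolution (A.indicator fun _ => (1 : ℂ))
      ((-A).indicator fun _ => (1 : ℂ)) (ContinuousLinearMap.mul ℂ ℂ) volume) x := by
  have hm : MeasurableSet (A ∩ (fun y => y - x) ⁻¹' A) :=
    hA.inter ((measurable_id.sub_const x) hA)
  rw [convolution_def, overlap, ← integral_indicator_one hm, ← integral_complex_ofReal]
  refine integral_congr_ae (ae_of_all _ fun y => ?_)
  by_cases h1 : y ∈ A <;> by_cases h2 : y - x ∈ A <;> simp [h1, h2, Set.indicator]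

/-- The Fourier transform of the overlap function is the square modulus of `expInt`. -/
theorem fourier_overlap (hb : Bornology.IsBounded A) (hA : MeasurableSet A) (u : Rd d) :
    𝓕 (fun x => (overlap A x : ℂ)) u = ((‖expInt A u‖ ^ 2 : ℝ) : ℂ) := by
  rw [funext (overlap_eq_convolution hA), Real.fourier_mul_convolution_eq
    (integrable_indicator_one hb hA) (integrable_indicator_one hb.neg hA.neg),
    fourier_indicator hA.nullMeasurableSet, fourier_indicator hA.neg.nullMeasurableSet]
  have h : expInt (-A) (-u) = expInt A u := by
    rw [expInt, expInt, ← integral_indicator hA.neg, ← integral_indicator hA,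
      ← integral_neg_eq_self]
    refine integral_congr_ae (ae_of_all _ fun y => ?_)
    by_cases h1 : y ∈ A <;> simp [h1, Set.indicator, expFun]
  rw [h, expInt_neg, ← Complex.normSq_eq_conj_mul_self, Complex.normSq_eq_norm_sq]

theorem integrable_overlap (hb : Bornology.IsBounded A) (hA : MeasurableSet A) :
    Integrable (overlap A) volume :=
  (continuous_overlap hb hA).integrable_of_hasCompactSupport (hasCompactSupport_overlap hb)

theorem integral_overlap_mul_expFun (hb : Bornology.IsBounded A) (hA : MeasurableSet A)
    (u : Rd d) : ∫ x, (overlap A x : ℂ) * expFun u x = ((‖expInt A u‖ ^ 2 : ℝ) : ℂ) := by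
  rw [← norm_expInt_neg, ← fourier_overlap hb hA, Real.fourier_eq]
  refine integral_congr_ae (ae_of_all _ fun x => ?_)
  simp [Circle.smul_def, expFun_eq_fourierChar, real_inner_comm, mul_comm]

/-- Square integrability of `expInt A`. -/
theorem lintegral_expInt_sq_lt_top (hb : Bornology.IsBounded A) (hA : MeasurableSet A) :
    ∫⁻ u, ‖expInt A u‖ₑ ^ 2 < ∞ := by
  have hcont := continuous_overlap hb hA
  set f : Rd d → ℂ := fun x => (overlap A x : ℂ) with hf
  have hfi : Integrable f volume := (integrable_overlap hb hA).ofReal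
  have hfc : ContinuousAt f 0 := (Complex.continuous_ofReal.comp hcont).continuousAt
  -- Gaussian averages of the overlap tend to its value at 0. Moving the Fourier transform off the
  -- Gaussian rewrites them as Gaussian-damped integrals of |`expInt`|², and Fatou's lemma then
  -- removes the damping.
  have h1 := Real.tendsto_integral_gaussian_smul' hfi hfc
  have h2 : ∀ᶠ c : ℝ in atTop, ∫ w : Rd d, ((Real.pi * c : ℂ) ^
      (Module.finrank ℝ (Rd d) / 2 : ℂ) * Complex.exp (-Real.pi ^ 2 * c * ‖0 - w‖ ^ 2)) • f w =
      ((∫ w : Rd d, Real.exp (-c⁻¹ * ‖w‖ ^ 2) * ‖expInt A w‖ ^ 2 : ℝ) : ℂ) := by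
    filter_upwards [Ioi_mem_atTop 0] with c (hc : 0 < c)
    have J : Integrable (fun w : Rd d => Complex.exp (-(c⁻¹ : ℂ) * ‖w‖ ^ 2)) := by
      simpa using GaussianFourier.integrable_cexp_neg_mul_sq_norm_add (V := Rd d)
        (b := (c⁻¹ : ℂ)) (by rw [← Complex.ofReal_inv, Complex.ofReal_re]; positivity) 0 0
    have h3 := VectorFourier.integral_fourierIntegral_smul_eq_flip (L := innerₗ (Rd d))
      (μ := volume) (ν := volume) Real.continuous_fourierChar continuous_inner J hfi
    rw [flip_innerₗ] at h3
    change ∫ w, 𝓕 (fun w : Rd d => Complex.exp (-(c⁻¹ : ℂ) * ‖w‖ ^ 2)) w • f w =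
      ∫ w, Complex.exp (-(c⁻¹ : ℂ) * ‖w‖ ^ 2) • 𝓕 f w at h3
    rw [← integral_complex_ofReal]
    refine Eq.trans ?_ (h3.trans ?_)
    · congr 1
      ext w
      rw [fourier_gaussian_innerProductSpace
        (by rw [← Complex.ofReal_inv, Complex.ofReal_re]; positivity)]
      simp [div_eq_mul_inv, mul_right_comm]
    · congr 1
      ext w
      rw [hf, fourier_overlap hb hA]
      push_cast
      rfl
  have hint (n : ℕ) : Integrable fun w : Rd d =>
      Real.exp (-((n : ℝ) + 1)⁻¹ * ‖w‖ ^ 2) * ‖expInt A w‖ ^ 2 := by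
    have J : Integrable (fun w : Rd d => Real.exp (-((n : ℝ) + 1)⁻¹ * ‖w‖ ^ 2)) volume :=
      by
      have hre : 0 < ((((n : ℝ) + 1)⁻¹ : ℝ) : ℂ).re := by
        rw [Complex.ofReal_re]; positivity
      have := (GaussianFourier.integrable_cexp_neg_mul_sq_norm_add (V := Rd d) hre 0 0).re
      refine this.congr (ae_of_all _ fun w => ?_)
      have h : -((((n : ℝ) + 1)⁻¹ : ℝ) : ℂ) * ‖w‖ ^ 2 + 0 * (inner ℝ (0 : Rd d) w : ℝ) =
          ((-((n : ℝ) + 1)⁻¹ * ‖w‖ ^ 2 : ℝ) : ℂ) := by push_cast; ring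
      dsimp only
      rw [h, ← Complex.ofReal_exp]
      exact Complex.ofReal_re _
    refine J.mul_bdd (c := volume.real A ^ 2)
      ((continuous_expInt hb).norm.pow 2).aestronglyMeasurable (ae_of_all _ fun w => ?_)
    rw [norm_pow, norm_norm]
    gcongr
    exact norm_expInt_le A w
  have h4 : ∫⁻ u, ‖expInt A u‖ₑ ^ 2 ≤ ENNReal.ofReal (overlap A 0) := by
    have hn : Tendsto (fun n : ℕ => (n : ℝ) + 1) atTop atTop :=
      tendsto_atTop_add_const_right _ _ tendsto_natCast_atTop_atTop
    have h5 : Tendsto (fun n : ℕ => ∫ w : Rd d,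
        Real.exp (-((n : ℝ) + 1)⁻¹ * ‖w‖ ^ 2) * ‖expInt A w‖ ^ 2) atTop (𝓝 (overlap A 0)) := by
      have := (Complex.continuous_re.tendsto _).comp ((h1.congr' h2).comp hn)
      simpa [Function.comp_def, hf] using this
    have h6 (w : Rd d) : Tendsto (fun n : ℕ => ENNReal.ofReal
        (Real.exp (-((n : ℝ) + 1)⁻¹ * ‖w‖ ^ 2) * ‖expInt A w‖ ^ 2)) atTop
        (𝓝 (‖expInt A w‖ₑ ^ 2)) := by
      rw [← ofReal_norm, ← ENNReal.ofReal_pow (norm_nonneg _)]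
      refine ENNReal.tendsto_ofReal ?_
      have := (((tendsto_inv_atTop_zero.comp hn).neg.mul_const (‖w‖ ^ 2)).rexp).mul_const
        (‖expInt A w‖ ^ 2)
      simpa using this
    calc ∫⁻ u, ‖expInt A u‖ₑ ^ 2 = ∫⁻ u, liminf (fun n : ℕ => ENNReal.ofReal
          (Real.exp (-((n : ℝ) + 1)⁻¹ * ‖u‖ ^ 2) * ‖expInt A u‖ ^ 2)) atTop :=
          lintegral_congr fun u => (h6 u).liminf_eq.symm
      _ ≤ liminf (fun n : ℕ => ∫⁻ u, ENNReal.ofReal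
          (Real.exp (-((n : ℝ) + 1)⁻¹ * ‖u‖ ^ 2) * ‖expInt A u‖ ^ 2)) atTop :=
          lintegral_liminf_le' fun n => (hint n).aestronglyMeasurable.aemeasurable.ennreal_ofReal
      _ = ENNReal.ofReal (overlap A 0) := by
          refine Tendsto.liminf_eq ((ENNReal.tendsto_ofReal h5).congr fun n => ?_)
          exact ofReal_integral_eq_lintegral_ofReal (hint n) (ae_of_all _ fun x => by positivity)
  exact h4.trans_lt ENNReal.ofReal_lt_top

end Exponentials

/-! ### Orthogonality and Parseval for a spectrum. -/

section Spectrum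

variable {d : ℕ} {Ω : Set (Rd d)}

theorem inner_expL2 (hb : Bornology.IsBounded Ω) (u v : Rd d) :
    inner ℂ (expL2 hb u) (expL2 hb v) = expInt Ω (v - u) := by
  rw [L2.inner_def, expInt]
  refine integral_congr_ae ?_
  filter_upwards [(memLp_expFun hb u).coeFn_toLp, (memLp_expFun hb v).coeFn_toLp] with x hu hv
  rw [expL2, expL2, hu, hv, expFun_sub_left, RCLike.inner_apply]

theorem IsSpectrum.expInt_sub_eq_zero {hb : Bornology.IsBounded Ω} {Λ : Set (Rd d)}
    (h : IsSpectrum hb Λ) {u v : Rd d} (hu : u ∈ Λ) (hv : v ∈ Λ) (huv : u ≠ v) :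
    expInt Ω (u - v) = 0 := by
  rw [← inner_expL2 hb]
  exact h.orthogonal v hv u hu huv.symm

/-- Parseval's identity for a spectrum. -/
theorem IsSpectrum.tsum_expInt {hb : Bornology.IsBounded Ω} {Λ : Set (Rd d)}
    (h : IsSpectrum hb Λ) (hpos : 0 < volume Ω) (u : Rd d) :
    ∑' s : Λ, ‖expInt Ω (u + s)‖ₑ ^ 2 = volume Ω ^ 2 := by
  have hm : 0 < volume.real Ω := ENNReal.toReal_pos hpos.ne' hb.measure_lt_top.ne
  set c : ℂ := (((√(volume.real Ω))⁻¹ : ℝ) : ℂ) with hc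
  have hc2 : c * c = ((volume.real Ω)⁻¹ : ℝ) := by
    rw [hc, ← Complex.ofReal_mul, ← mul_inv, Real.mul_self_sqrt hm.le]
  have hcn : ‖c‖ ^ 2 = (volume.real Ω)⁻¹ := by
    rw [sq, ← norm_mul, hc2, Complex.norm_of_nonneg (inv_nonneg.2 hm.le)]
  let v : Λ → Lp ℂ 2 (volume.restrict Ω) := fun s => c • expL2 hb s
  have hinner (x y : Lp ℂ 2 (volume.restrict Ω)) :
      inner ℂ (c • x) (c • y) = ((volume.real Ω)⁻¹ : ℝ) * inner ℂ x y := by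
    rw [inner_smul_left, inner_smul_right, ← mul_assoc, hc, Complex.conj_ofReal, ← hc, hc2]
  have hv : Orthonormal ℂ v := by
    rw [orthonormal_iff_ite]
    intro s t
    simp only [v, hinner]
    split_ifs with hst
    · rw [hst, inner_expL2, sub_self, expInt_zero, ← Complex.ofReal_mul, inv_mul_cancel₀ hm.ne',
        Complex.ofReal_one]
    · rw [h.orthogonal _ s.2 _ t.2 (fun h' => hst (Subtype.ext h')), mul_zero]
  have hspan : Submodule.span ℂ (expL2 hb '' Λ) ≤ Submodule.span ℂ (Set.range v) := by
    rw [Submodule.span_le]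
    rintro _ ⟨s, hs, rfl⟩
    have hc0 : c ≠ 0 := by
      rw [hc, Complex.ofReal_ne_zero]; positivity
    have : expL2 hb s = c⁻¹ • v ⟨s, hs⟩ := by simp [v, smul_smul, hc0]
    rw [this]
    exact Submodule.smul_mem _ _ (Submodule.subset_span (Set.mem_range_self _))
  let b := HilbertBasis.mk hv (by rw [← h.complete]; exact Submodule.topologicalClosure_mono hspan)
  have hb1 (s : Λ) : b s = v s := by simp [b]
  -- Parseval is applied to the exponential of frequency -u, whose coefficients are normalized
  -- values of `expInt` at u + s.
  have h1 := b.hasSum_inner_mul_inner (expL2 hb (-u)) (expL2 hb (-u))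
  have h2 (s : Λ) : inner ℂ (expL2 hb (-u)) (b s) * inner ℂ (b s) (expL2 hb (-u)) =
      (((volume.real Ω)⁻¹ * ‖expInt Ω (u + s)‖ ^ 2 : ℝ) : ℂ) := by
    rw [← inner_conj_symm (b s), hb1, RCLike.mul_conj, inner_smul_right, inner_expL2, norm_mul,
      sub_neg_eq_add, add_comm u, ← hcn, ← mul_pow, Complex.ofReal_pow]
    rfl
  simp_rw [h2] at h1
  rw [inner_expL2, sub_self, expInt_zero, Complex.hasSum_ofReal] at h1
  have h3 := h1.mul_left (volume.real Ω)
  simp only [← mul_assoc, mul_inv_cancel₀ hm.ne', one_mul] at h3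
  have h4 (s : Λ) : ‖expInt Ω (u + s)‖ₑ ^ 2 = ENNReal.ofReal (‖expInt Ω (u + s)‖ ^ 2) := by
    rw [← ofReal_norm, ENNReal.ofReal_pow (norm_nonneg _)]
  simp_rw [h4]
  rw [← ENNReal.ofReal_tsum_of_nonneg (fun _ => by positivity) h3.summable, h3.tsum_eq,
    ENNReal.ofReal_mul hm.le, measureReal_def, ENNReal.ofReal_toReal hb.measure_lt_top.ne, sq]

end Spectrum
-- Finite autocorrelations and their power densities.
section FiniteSets

variable {d : ℕ}

/-- The measure `|S|⁻¹ δ_S ∗ δ_{-S}` of a finite set `S`. -/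
noncomputable def autoMeasure (S : Finset (Rd d)) : Measure (Rd d) :=
  (S.card : ℝ≥0∞)⁻¹ • ∑ s ∈ S, ∑ t ∈ S, Measure.dirac (s - t)

/-- The density `|S|⁻¹ |∑_{s ∈ S} e_s|²`. -/
noncomputable def powerDensity (S : Finset (Rd d)) (x : Rd d) : ℝ :=
  (S.card : ℝ)⁻¹ * ‖∑ s ∈ S, expFun s x‖ ^ 2

/-- The measure with density `|S|⁻¹ |∑_{s ∈ S} e_s|²`, the Fourier transform of `autoMeasure S`. -/
noncomputable def powerMeasure (S : Finset (Rd d)) : Measure (Rd d) :=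
  volume.withDensity fun x => ENNReal.ofReal (powerDensity S x)

theorem powerDensity_nonneg (S : Finset (Rd d)) (x : Rd d) : 0 ≤ powerDensity S x := by
  unfold powerDensity; positivity

theorem continuous_powerDensity (S : Finset (Rd d)) : Continuous (powerDensity S) := by
  unfold powerDensity
  exact continuous_const.mul
    ((continuous_finsetSum _ fun s _ => continuous_expFun s).norm.pow 2)

theorem powerDensity_eq (S : Finset (Rd d)) (x : Rd d) :
    (powerDensity S x : ℂ) = (S.card : ℂ)⁻¹ * ∑ s ∈ S, ∑ t ∈ S, expFun (s - t) x := by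
  have h : ∑ s ∈ S, ∑ t ∈ S, expFun (s - t) x =
      (∑ s ∈ S, expFun s x) * starRingEnd ℂ (∑ s ∈ S, expFun s x) := by
    rw [map_sum, Finset.sum_mul_sum]
    simp_rw [expFun_sub_left]
  rw [h, Complex.mul_conj, Complex.normSq_eq_norm_sq, powerDensity]
  push_cast
  rfl

instance (S : Finset (Rd d)) : SFinite (autoMeasure S) := by
  unfold autoMeasure; infer_instance

instance (S : Finset (Rd d)) : SFinite (powerMeasure S) := by
  unfold powerMeasure; infer_instance

instance (S : Finset (Rd d)) : IsLocallyFiniteMeasure (powerMeasure S) :=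
  IsLocallyFiniteMeasure.withDensity_ofReal (continuous_powerDensity S)

theorem deltaSum_coe (S : Finset (Rd d)) : deltaSum (S : Set (Rd d)) = ∑ s ∈ S, Measure.dirac s := by
  rw [deltaSum, Measure.sum_fintype, ← Finset.sum_coe_sort S]
  rfl

theorem averagedAutocorrelation_eq {Λ : Set (Rd d)} {r : ℝ} {S : Finset (Rd d)}
    (hS : Λ ∩ Metric.ball 0 r = S) : averagedAutocorrelation Λ r = autoMeasure S := by
  classical
  have hneg : (-(S : Set (Rd d))) = ((S.image Neg.neg : Finset (Rd d)) : Set (Rd d)) := by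
    rw [Finset.coe_image, Set.image_neg_eq_neg]
  have h1 (T : Finset (Rd d)) (μ : Measure (Rd d)) [SFinite μ] :
      (∑ s ∈ T, Measure.dirac s).conv μ = ∑ s ∈ T, (Measure.dirac s).conv μ := by
    induction T using Finset.induction_on with
    | empty => simp
    | insert a T ha ih => rw [Finset.sum_insert ha, Finset.sum_insert ha, Measure.add_conv, ih]
  have h2 (T : Finset (Rd d)) (μ : Measure (Rd d)) [SFinite μ] :
      μ.conv (∑ s ∈ T, Measure.dirac s) = ∑ s ∈ T, μ.conv (Measure.dirac s) := by
    induction T using Finset.induction_on with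
    | empty => simp
    | insert a T ha ih => rw [Finset.sum_insert ha, Finset.sum_insert ha, Measure.conv_add, ih]
  rw [averagedAutocorrelation, hS, autoMeasure, hneg, deltaSum_coe, deltaSum_coe,
    Set.encard_coe_eq_coe_finsetCard, h1]
  congr 1
  refine Finset.sum_congr rfl fun s _ => ?_
  rw [h2, Finset.sum_image neg_injective.injOn]
  refine Finset.sum_congr rfl fun t _ => ?_
  rw [Measure.dirac_conv_dirac, sub_eq_add_neg]

theorem integral_autoMeasure {F : Type*} [NormedAddCommGroup F] [NormedSpace ℝ F] [CompleteSpace F]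
    (S : Finset (Rd d)) (f : Rd d → F) :
    ∫ x, f x ∂(autoMeasure S) = (S.card : ℝ)⁻¹ • ∑ s ∈ S, ∑ t ∈ S, f (s - t) := by
  have hi (x : Rd d) : Integrable f (Measure.dirac x) := integrable_dirac (by simp)
  rw [autoMeasure, integral_smul_measure, integral_finsetSum_measure
    fun s _ => integrable_finsetSum_measure.2 fun t _ => hi _]
  simp_rw [integral_finsetSum_measure fun t _ => hi _, integral_dirac]
  simp

theorem autoMeasure_apply (S : Finset (Rd d)) (U : Set (Rd d)) :
    autoMeasure S U = (S.card : ℝ≥0∞)⁻¹ * ∑ s ∈ S, ∑ t ∈ S, U.indicator 1 (s - t) := by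
  simp [autoMeasure, Measure.finsetSum_apply]

theorem integral_powerMeasure (S : Finset (Rd d)) {f : Rd d → ℂ} (hf : Integrable f volume) :
    ∫ x, f x ∂(powerMeasure S) =
      (S.card : ℂ)⁻¹ * ∑ s ∈ S, ∑ t ∈ S, ∫ x, f x * expFun (s - t) x := by
  have hi (u : Rd d) : Integrable (fun x => f x * expFun u x) volume :=
    hf.mul_bdd (c := 1) (continuous_expFun u).aestronglyMeasurable
      (ae_of_all _ fun x => (norm_expFun u x).le)
  rw [powerMeasure, integral_withDensity_eq_integral_toReal_smul
    (continuous_powerDensity S).measurable.ennreal_ofReal (ae_of_all _ fun x => by simp)]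
  have h (x : Rd d) : (ENNReal.ofReal (powerDensity S x)).toReal • f x =
      (S.card : ℂ)⁻¹ * ∑ s ∈ S, ∑ t ∈ S, f x * expFun (s - t) x := by
    rw [ENNReal.toReal_ofReal (powerDensity_nonneg S x), Complex.real_smul, powerDensity_eq,
      mul_assoc, mul_comm _ (f x), Finset.mul_sum]
    simp_rw [Finset.mul_sum]
  simp_rw [h]
  rw [integral_const_mul, integral_finsetSum _ fun s _ => integrable_finsetSum _ fun t _ => hi _]
  simp_rw [integral_finsetSum S fun t _ => hi _]

theorem integral_fourier_autoMeasure (S : Finset (Rd d)) (f : 𝓢(Rd d, ℂ)) :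
    ∫ x, (𝓕 f) x ∂(autoMeasure S) = ∫ x, f x ∂(powerMeasure S) := by
  have h (u : Rd d) : (𝓕 f) u = ∫ x, f x * expFun (-u) x := by
    rw [SchwartzMap.fourier_coe, Real.fourier_eq]
    refine integral_congr_ae (ae_of_all _ fun x => ?_)
    simp [Circle.smul_def, expFun_eq_fourierChar, real_inner_comm, mul_comm]
  -- The double sum is reordered because the transform at s - t carries the frequency t - s.
  rw [integral_autoMeasure, integral_powerMeasure S f.integrable, Finset.sum_comm]
  simp_rw [h, neg_sub]
  rw [Complex.real_smul]
  push_cast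
  rfl

variable {A : Set (Rd d)} {S : Finset (Rd d)}

theorem integral_overlap_powerMeasure (hb : Bornology.IsBounded A) (hA : MeasurableSet A)
    (S : Finset (Rd d)) (u : Rd d) :
    ∫ x, (overlap A x : ℂ) * expFun u x ∂(powerMeasure S) =
      (((S.card : ℝ)⁻¹ * ∑ t ∈ S, ∑ s ∈ S, ‖expInt A (u + (s - t))‖ ^ 2 : ℝ) : ℂ) := by
  have hi : Integrable (fun x => (overlap A x : ℂ) * expFun u x) volume :=
    (integrable_overlap hb hA).ofReal.mul_bdd (c := 1) (continuous_expFun u).aestronglyMeasurable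
      (ae_of_all _ fun x => (norm_expFun u x).le)
  rw [integral_powerMeasure S hi, Finset.sum_comm]
  simp_rw [mul_assoc, ← expFun_add_left, integral_overlap_mul_expFun hb hA]
  push_cast
  rfl

/-- Translating by y only multiplies each term by a phase, so orthogonality kills every off-diagonal
term and the diagonal contributes |S| times the volume of A. The bound is an equality when S is
nonempty. -/
theorem powerMeasure_translate_le (hb : Bornology.IsBounded A) (hA : MeasurableSet A)
    (hS : ∀ s ∈ S, ∀ t ∈ S, s ≠ t → expInt A (s - t) = 0) (y : Rd d) :
    powerMeasure S ((fun x => x - y) ⁻¹' A) ≤ volume A := by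
  have hAy : MeasurableSet ((fun x => x - y) ⁻¹' A) := (measurable_id.sub_const y) hA
  have hby : Bornology.IsBounded ((fun x => x - y) ⁻¹' A) := by
    obtain ⟨R, hR⟩ := hb.subset_closedBall 0
    refine (Metric.isBounded_closedBall (x := y) (r := R)).subset fun x hx => ?_
    rw [Metric.mem_closedBall, dist_eq_norm]
    simpa using hR hx
  have hshift (u : Rd d) : ∫ x, ((fun x => x - y) ⁻¹' A).indicator (fun _ => (1 : ℂ)) x *
      expFun u x = expFun u y * expInt A u := by
    have h1 := integral_sub_right_eq_self (μ := volume)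
      (fun x => A.indicator (fun _ => (1 : ℂ)) x * expFun u (x + y)) y
    rw [expInt, ← integral_const_mul, ← integral_indicator hA]
    refine Eq.trans ?_ (h1.trans ?_)
    · refine integral_congr_ae (ae_of_all _ fun x => ?_)
      simp only [Set.indicator, Set.mem_preimage, sub_add_cancel, ite_mul, one_mul, zero_mul]
      rfl
    · refine integral_congr_ae (ae_of_all _ fun x => ?_)
      by_cases hx : x ∈ A <;> simp [hx, expFun_add_right, mul_comm]
  have h2 := integral_powerMeasure S (integrable_indicator_one hby hAy)
  simp_rw [hshift] at h2
  have h3 : ∀ s ∈ S, ∑ t ∈ S, expFun (s - t) y * expInt A (s - t) = volume.real A := by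
    intro s hs
    rw [Finset.sum_eq_single_of_mem s hs fun t ht hts => by rw [hS s hs t ht hts.symm, mul_zero],
      sub_self, expFun_zero_left, expInt_zero, one_mul]
  rw [Finset.sum_congr rfl h3, Finset.sum_const, nsmul_eq_mul, integral_indicator hAy,
    integral_const, measureReal_restrict_apply_univ] at h2
  have h4 : (powerMeasure S).real ((fun x => x - y) ⁻¹' A) ≤ volume.real A := by
    rcases S.eq_empty_or_nonempty with rfl | hne
    · simp only [Finset.card_empty, Nat.cast_zero, inv_zero, zero_mul, Complex.real_smul,
        mul_one, Complex.ofReal_eq_zero] at h2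
      rw [h2]
      exact measureReal_nonneg
    · have hc : (S.card : ℂ) ≠ 0 := by exact_mod_cast hne.card_pos.ne'
      rw [inv_mul_cancel_left₀ hc, Complex.real_smul, mul_one, Complex.ofReal_inj] at h2
      exact h2.le
  exact (ENNReal.toReal_le_toReal hby.measure_lt_top.ne hb.measure_lt_top.ne).1 h4

variable {δ : ℝ}

theorem sum_indicator_ball_le_one (hS : ∀ s ∈ S, ∀ t ∈ S, s ≠ t → δ ≤ ‖s - t‖) (y : Rd d) :
    ∑ s ∈ S, (Metric.ball y (δ / 2)).indicator (1 : Rd d → ℝ≥0∞) s ≤ 1 := by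
  classical
  by_cases h : ∃ s ∈ S, s ∈ Metric.ball y (δ / 2)
  · obtain ⟨s, hs, hsy⟩ := h
    rw [Finset.sum_eq_single_of_mem s hs]
    · simp [hsy]
    · intro t ht hts
      refine Set.indicator_of_notMem (fun hty => ?_) _
      have h1 := hS t ht s hs hts
      rw [Metric.mem_ball] at hsy hty
      have h2 := dist_triangle_right t s y
      rw [dist_eq_norm t s] at h2
      linarith
  · push Not at h
    rw [Finset.sum_eq_zero fun s hs => Set.indicator_of_notMem (h s hs) _]
    exact zero_le_one

/-- For each fixed t, separation leaves at most one s in the ball of radius δ/2 about y + t.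
Averaging over t gives the bound. -/
theorem autoMeasure_translate_le (hS : ∀ s ∈ S, ∀ t ∈ S, s ≠ t → δ ≤ ‖s - t‖) (y : Rd d) :
    autoMeasure S ((fun x => x - y) ⁻¹' Metric.ball 0 (δ / 2)) ≤ 1 := by
  rw [autoMeasure_apply, Finset.sum_comm]
  calc (S.card : ℝ≥0∞)⁻¹ * ∑ t ∈ S, ∑ s ∈ S,
        ((fun x => x - y) ⁻¹' Metric.ball 0 (δ / 2)).indicator 1 (s - t)
      ≤ (S.card : ℝ≥0∞)⁻¹ * ∑ t ∈ S, 1 := by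
        gcongr with t ht
        refine le_trans (le_of_eq ?_) (sum_indicator_ball_le_one hS (y + t))
        refine Finset.sum_congr rfl fun s _ => ?_
        simp [Set.indicator, dist_eq_norm, sub_sub, add_comm]
    _ ≤ 1 := by simp [ENNReal.inv_mul_le_one]

/-- A packing bound, which yields local finiteness and polynomial growth of a separated set. -/
theorem card_mul_volume_ball_le (hS : ∀ s ∈ S, ∀ t ∈ S, s ≠ t → δ ≤ ‖s - t‖) {r : ℝ}
    (hSr : (S : Set (Rd d)) ⊆ Metric.ball 0 r) :
    S.card * volume (Metric.ball (0 : Rd d) (δ / 2)) ≤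
      volume (Metric.ball (0 : Rd d) (r + δ / 2)) := by
  have h := measure_mul_ball_le volume (μ := ∑ s ∈ S, Measure.dirac s) measurableSet_ball
    (A := Metric.ball 0 (δ / 2)) Metric.ball_subset_closedBall ENNReal.one_ne_top (fun y => ?_) 0 r
  · rw [one_mul, Measure.finsetSum_apply, Finset.sum_congr rfl
      (g := fun _ => 1) fun s hs => by rw [Measure.dirac_apply]; simp [hSr hs]] at h
    simpa [mul_comm] using h
  · rw [Measure.finsetSum_apply]
    refine le_trans (le_of_eq ?_) (sum_indicator_ball_le_one hS y)
    refine Finset.sum_congr rfl fun s _ => ?_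
    rw [Measure.dirac_apply]
    simp [Set.indicator, dist_eq_norm]

theorem autoMeasure_eq_zero {U : Set (Rd d)} (h : ∀ s ∈ S, ∀ t ∈ S, s - t ∉ U) :
    autoMeasure S U = 0 := by
  rw [autoMeasure_apply, Finset.sum_eq_zero fun s hs => Finset.sum_eq_zero fun t ht =>
    Set.indicator_of_notMem (h s hs t ht) _, mul_zero]

theorem integral_autoMeasure_eq_apply_zero (hne : S.Nonempty) {f : Rd d → ℝ}
    (h : ∀ s ∈ S, ∀ t ∈ S, s ≠ t → f (s - t) = 0) : ∫ x, f x ∂(autoMeasure S) = f 0 := by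
  have h1 : ∀ s ∈ S, ∑ t ∈ S, f (s - t) = f 0 := fun s hs => by
    rw [Finset.sum_eq_single_of_mem s hs fun t ht hts => h s hs t ht hts.symm, sub_self]
  rw [integral_autoMeasure, Finset.sum_congr rfl h1, Finset.sum_const, nsmul_eq_mul, smul_eq_mul,
    inv_mul_cancel_left₀]
  exact_mod_cast hne.card_pos.ne'

end FiniteSets
-- The Parseval defect of a finite piece of the spectrum.
section Defect

variable {d : ℕ} {A : Set (Rd d)} {S : Finset (Rd d)} {Λ : Set (Rd d)}

theorem sum_add_tsum_diff (f : Rd d → ℝ≥0∞) (hS : (S : Set (Rd d)) ⊆ Λ) :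
    ∑ s ∈ S, f s + ∑' s : ↥(Λ \ S), f s = ∑' s : Λ, f s := by
  have h := ENNReal.summable.tsum_union_disjoint (f := f) (s := (S : Set (Rd d))) (t := Λ \ S)
    Set.disjoint_sdiff_right ENNReal.summable
  rw [Finset.tsum_subtype' S f, Set.union_sdiff_cancel hS] at h
  exact h.symm

/-- Parseval's identity turns the defect `∫ (1 - cos) overlap` into a sum over the points of `Λ`
outside of `S`. -/
theorem ofReal_integral_overlap_mul_one_sub_cos (hb : Bornology.IsBounded A)
    (hA : MeasurableSet A) (hΛ : ∀ u, ∑' s : Λ, ‖expInt A (u + s)‖ₑ ^ 2 = volume A ^ 2)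
    (horth : ∀ s ∈ S, ∀ t ∈ S, s ≠ t → expInt A (s - t) = 0)
    (hS : (S : Set (Rd d)) ⊆ Λ) (u : Rd d) :
    ENNReal.ofReal
        (∫ x, overlap A x * (1 - Real.cos (2 * Real.pi * inner ℝ u x)) ∂(powerMeasure S)) =
      (S.card : ℝ≥0∞)⁻¹ * ∑ t ∈ S, ∑' s : ↥(Λ \ S), ‖expInt A (u + (s - t))‖ₑ ^ 2 := by
  have hfin : volume A ≠ ∞ := hb.measure_lt_top.ne
  have hi (v : Rd d) :
      Integrable (fun x => (overlap A x : ℂ) * expFun v x) (powerMeasure S) := by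
    refine ((Complex.continuous_ofReal.comp (continuous_overlap hb hA)).mul
      (continuous_expFun v)).integrable_of_hasCompactSupport ?_
    exact HasCompactSupport.mul_right (f := fun x => (overlap A x : ℂ))
      ((hasCompactSupport_overlap hb).comp_left Complex.ofReal_zero)
  have hre (x : Rd d) : overlap A x * (1 - Real.cos (2 * Real.pi * inner ℝ u x)) =
      ((overlap A x : ℂ) * expFun 0 x - (overlap A x : ℂ) * expFun u x).re := by
    rw [← mul_sub, Complex.re_ofReal_mul, Complex.sub_re, expFun_re u, expFun_zero_left,
      Complex.one_re]
  have hdiag : ∀ t ∈ S, ∑ s ∈ S, ‖expInt A (0 + (s - t))‖ ^ 2 = volume.real A ^ 2 := by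
    intro t ht
    rw [Finset.sum_eq_single_of_mem t ht fun s hs hst => by
      rw [zero_add, horth s hs t ht hst]; simp]
    simp [expInt_zero]
  have hq : ∫ x, overlap A x * (1 - Real.cos (2 * Real.pi * inner ℝ u x)) ∂(powerMeasure S) =
      (S.card : ℝ)⁻¹ * ∑ t ∈ S, (volume.real A ^ 2 - ∑ s ∈ S, ‖expInt A (u + (s - t))‖ ^ 2) := by
    simp_rw [hre]
    have h1 := integral_re (𝕜 := ℂ) ((hi 0).sub (hi u))
    simp only [Pi.sub_apply, RCLike.re_eq_complex_re] at h1
    rw [h1, integral_sub (hi 0) (hi u), integral_overlap_powerMeasure hb hA,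
      integral_overlap_powerMeasure hb hA, Finset.sum_congr rfl hdiag, ← Complex.ofReal_sub,
      Complex.ofReal_re, ← mul_sub, ← Finset.sum_sub_distrib]
  -- The diagonal value is also the full Parseval sum over Λ at u - t. Subtracting the terms with s
  -- in S leaves those outside S.
  have hterm : ∀ t ∈ S, ENNReal.ofReal
        (volume.real A ^ 2 - ∑ s ∈ S, ‖expInt A (u + (s - t))‖ ^ 2) =
      ∑' s : ↥(Λ \ S), ‖expInt A (u + (s - t))‖ₑ ^ 2 ∧
      0 ≤ volume.real A ^ 2 - ∑ s ∈ S, ‖expInt A (u + (s - t))‖ ^ 2 := by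
    intro t _
    have h1 := sum_add_tsum_diff (fun s => ‖expInt A (u + (s - t))‖ₑ ^ 2) hS
    have h2 : ∑' s : Λ, ‖expInt A (u + (s - t))‖ₑ ^ 2 = volume A ^ 2 := by
      rw [← hΛ (u - t)]
      refine tsum_congr fun s => ?_
      rw [sub_add_eq_add_sub, add_sub_assoc]
    have h3 : ∑ s ∈ S, ‖expInt A (u + (s - t))‖ₑ ^ 2 =
        ENNReal.ofReal (∑ s ∈ S, ‖expInt A (u + (s - t))‖ ^ 2) := by
      rw [ENNReal.ofReal_sum_of_nonneg fun s _ => by positivity]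
      refine Finset.sum_congr rfl fun s _ => ?_
      rw [ENNReal.ofReal_pow (norm_nonneg _), ofReal_norm]
    have h4 : volume A ^ 2 = ENNReal.ofReal (volume.real A ^ 2) := by
      rw [ENNReal.ofReal_pow measureReal_nonneg, ofReal_measureReal hfin]
    rw [h2, h3, h4] at h1
    constructor
    · rw [ENNReal.ofReal_sub _ (Finset.sum_nonneg fun s _ => by positivity), ← h1,
        ENNReal.add_sub_cancel_left ENNReal.ofReal_ne_top]
    · rw [sub_nonneg, ← ENNReal.ofReal_le_ofReal_iff (by positivity), ← h1]
      exact le_self_add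
  -- For empty S both sides are 0: the sums are empty, and ∞ · 0 = 0 in `ℝ≥0∞`.
  rcases S.eq_empty_or_nonempty with rfl | hne
  · rw [hq]; simp
  · have hc : (0 : ℝ) < S.card := by exact_mod_cast hne.card_pos
    rw [hq, ENNReal.ofReal_mul (by positivity), ENNReal.ofReal_inv_of_pos hc,
      ENNReal.ofReal_natCast, ENNReal.ofReal_sum_of_nonneg fun t ht => (hterm t ht).2]
    congr 1
    exact Finset.sum_congr rfl fun t ht => (hterm t ht).1

theorem measurable_ofReal_defect (hb : Bornology.IsBounded A)
    (hA : MeasurableSet A) (hc : Λ.Countable)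
    (hΛ : ∀ u, ∑' s : Λ, ‖expInt A (u + s)‖ₑ ^ 2 = volume A ^ 2)
    (horth : ∀ s ∈ S, ∀ t ∈ S, s ≠ t → expInt A (s - t) = 0)
    (hS : (S : Set (Rd d)) ⊆ Λ) :
    Measurable fun u : Rd d => ENNReal.ofReal
      (∫ x, overlap A x * (1 - Real.cos (2 * Real.pi * inner ℝ u x)) ∂(powerMeasure S)) := by
  have hcont : Continuous fun u => ‖expInt A u‖ₑ ^ 2 :=
    (ENNReal.continuous_pow 2).comp (continuous_expInt hb).enorm
  have : Countable ↥(Λ \ S) := (hc.mono Set.sdiff_subset).to_subtype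
  simp_rw [ofReal_integral_overlap_mul_one_sub_cos hb hA hΛ horth hS]
  exact (Finset.measurable_sum _ fun t _ => Measurable.tsum fun s =>
    (hcont.comp (continuous_id.add_const _)).measurable).const_mul _

/-- The crude bound, used for the points t that may lie close to Λ \ S. -/
theorem lintegral_tsum_expInt_le
    (hΛ : ∀ u, ∑' s : Λ, ‖expInt A (u + s)‖ₑ ^ 2 = volume A ^ 2) (B : Set (Rd d)) (t : Rd d) :
    ∫⁻ u in B, ∑' s : ↥(Λ \ S), ‖expInt A (u + (s - t))‖ₑ ^ 2 ≤ volume A ^ 2 * volume B := by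
  calc ∫⁻ u in B, ∑' s : ↥(Λ \ S), ‖expInt A (u + (s - t))‖ₑ ^ 2
      ≤ ∫⁻ _ in B, volume A ^ 2 := by
        refine lintegral_mono fun u => ?_
        rw [← hΛ (u - t)]
        refine le_trans (le_of_eq (tsum_congr fun s => ?_))
          (ENNReal.tsum_mono_subtype (fun s => ‖expInt A (u - t + s)‖ₑ ^ 2)
            (Set.sdiff_subset (s := Λ) (t := (S : Set (Rd d)))))
        rw [sub_add_eq_add_sub, add_sub_assoc]
    _ = volume A ^ 2 * volume B := by rw [setLIntegral_const]

/-- Substitution turns each term into an integral over the ball of radius η about s - t. By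
separation these balls are disjoint, and they all avoid the ball of radius ρ - η, so together they
see only the tail. -/
theorem lintegral_tsum_expInt_le_tail (hb : Bornology.IsBounded A) (hc : Λ.Countable)
    {η ρ : ℝ} (hsep : ∀ s ∈ Λ, ∀ t ∈ Λ, s ≠ t → 2 * η ≤ ‖s - t‖) {t : Rd d}
    (ht : ∀ s ∈ Λ, s ∉ S → ρ ≤ ‖s - t‖) :
    ∫⁻ u in Metric.ball 0 η, ∑' s : ↥(Λ \ S), ‖expInt A (u + (s - t))‖ₑ ^ 2 ≤
      ∫⁻ u in (Metric.ball 0 (ρ - η))ᶜ, ‖expInt A u‖ₑ ^ 2 := by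
  have hcont : Continuous fun u => ‖expInt A u‖ₑ ^ 2 :=
    (ENNReal.continuous_pow 2).comp (continuous_expInt hb).enorm
  have : Countable ↥(Λ \ S) := (hc.mono Set.sdiff_subset).to_subtype
  have hm (s : ↥(Λ \ S)) : Measurable fun u => ‖expInt A (u + (s - t))‖ₑ ^ 2 :=
    (hcont.comp (continuous_id.add_const _)).measurable
  rw [lintegral_tsum fun s => (hm s).aemeasurable]
  have h1 (s : ↥(Λ \ S)) : ∫⁻ u in Metric.ball 0 η, ‖expInt A (u + (s - t))‖ₑ ^ 2 =
      ∫⁻ u in Metric.ball ((s : Rd d) - t) η, ‖expInt A u‖ₑ ^ 2 := by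
    rw [← lintegral_indicator measurableSet_ball, ← lintegral_indicator measurableSet_ball,
      ← lintegral_add_right_eq_self
        ((Metric.ball ((s : Rd d) - t) η).indicator fun u => ‖expInt A u‖ₑ ^ 2) ((s : Rd d) - t)]
    refine lintegral_congr fun u => ?_
    simp only [Set.indicator, Metric.mem_ball, dist_eq_norm, add_sub_cancel_right, sub_zero]
  simp_rw [h1]
  rw [← lintegral_iUnion (fun _ => measurableSet_ball)]
  · refine lintegral_mono_set ?_
    refine Set.iUnion_subset fun s u hu => ?_
    have h2 := ht s s.2.1 s.2.2
    rw [Metric.mem_ball, dist_eq_norm] at hu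
    simp only [Set.mem_compl_iff, mem_ball_zero_iff, not_lt]
    have h3 : ‖(s : Rd d) - t‖ ≤ ‖u‖ + ‖u - (s - t)‖ := by
      simpa using norm_sub_le u (u - (s - t))
    linarith
  · intro s s' hss
    refine Metric.ball_disjoint_ball ?_
    rw [dist_eq_norm, sub_sub_sub_cancel_right, ← two_mul]
    exact hsep s s.2.1 s' s'.2.1 fun h => hss (Subtype.ext h)

theorem tendsto_lintegral_expInt_tail (hb : Bornology.IsBounded A) (hA : MeasurableSet A) (η : ℝ) :
    Tendsto (fun n : ℕ => ∫⁻ u in (Metric.ball 0 (n - η))ᶜ, ‖expInt A u‖ₑ ^ 2) atTop (𝓝 0) := by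
  set D : Measure (Rd d) := volume.withDensity fun u => ‖expInt A u‖ₑ ^ 2
  have : IsFiniteMeasure D := isFiniteMeasure_withDensity (lintegral_expInt_sq_lt_top hb hA).ne
  have h1 := tendsto_measure_iInter_atTop (μ := D) (s := fun n : ℕ => (Metric.ball 0 (n - η))ᶜ)
    (fun n => measurableSet_ball.compl.nullMeasurableSet)
    (fun m n hmn => Set.compl_subset_compl.2 (Metric.ball_subset_ball (by gcongr)))
    ⟨0, measure_ne_top _ _⟩
  have h2 : ⋂ n : ℕ, (Metric.ball (0 : Rd d) (n - η))ᶜ = ∅ := by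
    refine Set.eq_empty_of_forall_notMem fun u hu => ?_
    obtain ⟨n, hn⟩ := exists_nat_gt (‖u‖ + η)
    refine Set.mem_iInter.1 hu n ?_
    rw [mem_ball_zero_iff]
    linarith
  rw [h2, measure_empty] at h1
  exact h1.congr fun n => withDensity_apply _ measurableSet_ball.compl

/-- The averaged defect is small if most points of `S` are far from `Λ \ S`. -/
theorem lintegral_defect_le (hb : Bornology.IsBounded A)
    (hA : MeasurableSet A) (hc : Λ.Countable)
    (hΛ : ∀ u, ∑' s : Λ, ‖expInt A (u + s)‖ₑ ^ 2 = volume A ^ 2)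
    (horth : ∀ s ∈ S, ∀ t ∈ S, s ≠ t → expInt A (s - t) = 0)
    (hS : (S : Set (Rd d)) ⊆ Λ) {η ρ : ℝ}
    (hsep : ∀ s ∈ Λ, ∀ t ∈ Λ, s ≠ t → 2 * η ≤ ‖s - t‖) {T : Finset (Rd d)} (hTS : T ⊆ S)
    (hT : ∀ t ∈ T, ∀ s ∈ Λ, s ∉ S → ρ ≤ ‖s - t‖) :
    ∫⁻ u in Metric.ball 0 η, ENNReal.ofReal
        (∫ x, overlap A x * (1 - Real.cos (2 * Real.pi * inner ℝ u x)) ∂(powerMeasure S)) ≤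
      (∫⁻ u in (Metric.ball 0 (ρ - η))ᶜ, ‖expInt A u‖ₑ ^ 2) +
        (S.card : ℝ≥0∞)⁻¹ * (S.card - T.card : ℕ) *
          (volume A ^ 2 * volume (Metric.ball (0 : Rd d) η)) := by
  classical
  have hcont : Continuous fun u => ‖expInt A u‖ₑ ^ 2 :=
    (ENNReal.continuous_pow 2).comp (continuous_expInt hb).enorm
  have : Countable ↥(Λ \ S) := (hc.mono Set.sdiff_subset).to_subtype
  have hm (t : Rd d) : Measurable fun u => ∑' s : ↥(Λ \ S), ‖expInt A (u + (s - t))‖ₑ ^ 2 :=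
    Measurable.tsum fun s => (hcont.comp (continuous_id.add_const _)).measurable
  simp_rw [ofReal_integral_overlap_mul_one_sub_cos hb hA hΛ horth hS]
  rw [lintegral_const_mul _ (Finset.measurable_sum _ fun t _ => hm t),
    lintegral_finsetSum _ fun t _ => hm t, ← Finset.sum_sdiff hTS, mul_add, add_comm]
  refine add_le_add ?_ ?_
  · calc (S.card : ℝ≥0∞)⁻¹ * ∑ t ∈ T, ∫⁻ u in Metric.ball 0 η,
          ∑' s : ↥(Λ \ S), ‖expInt A (u + (s - t))‖ₑ ^ 2
        ≤ (S.card : ℝ≥0∞)⁻¹ *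
          ∑ t ∈ T, ∫⁻ u in (Metric.ball 0 (ρ - η))ᶜ, ‖expInt A u‖ₑ ^ 2 :=
          mul_le_mul' le_rfl (Finset.sum_le_sum fun t ht =>
            lintegral_tsum_expInt_le_tail hb hc hsep (hT t ht))
      _ ≤ ((S.card : ℝ≥0∞)⁻¹ * S.card) *
          ∫⁻ u in (Metric.ball 0 (ρ - η))ᶜ, ‖expInt A u‖ₑ ^ 2 := by
          rw [Finset.sum_const, nsmul_eq_mul, mul_assoc]
          gcongr
      _ ≤ _ := mul_le_of_le_one_left zero_le (ENNReal.inv_mul_le_one _)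
  · rw [mul_assoc]
    gcongr
    rw [← Finset.card_sdiff_of_subset hTS, ← nsmul_eq_mul]
    exact Finset.sum_le_card_nsmul _ _ _ fun t _ => lintegral_tsum_expInt_le hΛ _ t

end Defect

/-! ### Radii with few points near the boundary. -/

/-- A monotone function of polynomial growth has large radii at which it is nearly constant. -/
theorem exists_radius_of_polynomial_growth {N : ℝ → ℝ} (hN : Monotone N) {C R₀ : ℝ} {d : ℕ}
    (hpoly : ∀ r, R₀ ≤ r → N r ≤ C * (r + 1) ^ d) (hR₀ : 0 < N R₀) (h0 : 0 ≤ R₀) {ε h : ℝ}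
    (hε : 0 < ε) (hε1 : ε < 1) (hh : 0 ≤ h) (R : ℝ) :
    ∃ r, R ≤ r ∧ R₀ ≤ r ∧ N r - N (r - h) ≤ ε * N r := by
  -- Otherwise each step of length h multiplies N by more than 1 / (1 - ε), and geometric growth
  -- beats the polynomial bound.
  by_contra! hcon
  set r₀ := max R R₀ with hr₀
  set q := 1 - ε with hq
  have hq0 : 0 < q := by linarith
  have hr₀0 : 0 ≤ r₀ := h0.trans (le_max_right _ _)
  have hstep (k : ℕ) : N r₀ ≤ q ^ k * N (r₀ + k * h) := by
    induction k with
    | zero => simp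
    | succ k ih =>
      have hk : 0 ≤ ((k + 1 : ℕ) : ℝ) * h := by positivity
      have h1 := hcon (r₀ + (k + 1 : ℕ) * h) (by linarith [le_max_left R R₀])
        (by linarith [le_max_right R R₀])
      have h2 : r₀ + (k + 1 : ℕ) * h - h = r₀ + k * h := by push_cast; ring
      rw [h2] at h1
      calc N r₀ ≤ q ^ k * N (r₀ + k * h) := ih
        _ ≤ q ^ k * (q * N (r₀ + (k + 1 : ℕ) * h)) := by
            gcongr
            rw [hq]
            linarith
        _ = q ^ (k + 1) * N (r₀ + (k + 1 : ℕ) * h) := by ring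
  have hbound (k : ℕ) : N r₀ * q ≤
      (|C| * (r₀ + 1 + h) ^ d) * (((k + 1 : ℕ) : ℝ) ^ d * q ^ (k + 1)) := by
    have hkh : 0 ≤ (k : ℝ) * h := by positivity
    calc N r₀ * q ≤ q ^ k * N (r₀ + k * h) * q := by gcongr; exact hstep k
      _ ≤ q ^ k * (|C| * (r₀ + k * h + 1) ^ d) * q := by
          gcongr
          refine (hpoly _ (by linarith [le_max_right R R₀])).trans ?_
          gcongr
          exact le_abs_self C
      _ ≤ q ^ k * (|C| * ((r₀ + 1 + h) * (k + 1 : ℕ)) ^ d) * q := by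
          gcongr
          push_cast
          have : 0 ≤ (k : ℝ) * r₀ := by positivity
          nlinarith [Nat.cast_nonneg (α := ℝ) k]
      _ = _ := by rw [mul_pow]; ring
  have hlim : Tendsto (fun k : ℕ => (|C| * (r₀ + 1 + h) ^ d) *
      (((k + 1 : ℕ) : ℝ) ^ d * q ^ (k + 1))) atTop (𝓝 0) := by
    have h1 := tendsto_pow_const_mul_const_pow_of_abs_lt_one d
      (show |q| < 1 by rw [abs_of_pos hq0]; linarith)
    simpa using ((tendsto_add_atTop_iff_nat 1).2 h1).const_mul (|C| * (r₀ + 1 + h) ^ d)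
  have h1 := ge_of_tendsto' hlim hbound
  have h2 : 0 < N r₀ := hR₀.trans_le (hN (le_max_right _ _))
  nlinarith [mul_pos h2 hq0]

section Radii

variable {d : ℕ} {A : Set (Rd d)} {Λ : Set (Rd d)} {δ : ℝ}

/-- The value at 0 is the volume of A. Combined with orthogonality, this forces distinct points of Λ
to be δ apart. -/
theorem exists_expInt_ne_zero (hb : Bornology.IsBounded A) (hpos : 0 < volume A) :
    ∃ δ > 0, ∀ u, ‖u‖ < δ → expInt A u ≠ 0 := by
  have h0 : expInt A 0 ≠ 0 := by
    rw [expInt_zero, Complex.ofReal_ne_zero]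
    exact (ENNReal.toReal_pos hpos.ne' hb.measure_lt_top.ne).ne'
  obtain ⟨δ, hδ, h⟩ := Metric.eventually_nhds_iff.1
    ((continuous_expInt hb).continuousAt.eventually_ne h0)
  exact ⟨δ, hδ, fun u hu => h (by simpa using hu)⟩

theorem finite_inter_ball (hδ : 0 < δ) (hsep : ∀ s ∈ Λ, ∀ t ∈ Λ, s ≠ t → δ ≤ ‖s - t‖) (r : ℝ) :
    (Λ ∩ Metric.ball 0 r).Finite := by
  by_contra hinf
  have hv : volume (Metric.ball (0 : Rd d) (δ / 2)) ≠ 0 :=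
    (Metric.measure_ball_pos volume _ (half_pos hδ)).ne'
  have htop : volume (Metric.ball (0 : Rd d) (r + δ / 2)) /
      volume (Metric.ball (0 : Rd d) (δ / 2)) ≠ ∞ := ENNReal.div_ne_top measure_ball_lt_top.ne hv
  obtain ⟨n, hn⟩ := ENNReal.exists_nat_gt htop
  obtain ⟨S, hS, hcard⟩ := Set.Infinite.exists_subset_card_eq hinf n
  have h1 := card_mul_volume_ball_le (S := S)
    (fun s hs t ht => hsep s (hS hs).1 t (hS ht).1) (fun s hs => (hS hs).2)
  rw [hcard, ← ENNReal.le_div_iff_mul_le (Or.inl hv) (Or.inl measure_ball_lt_top.ne)] at h1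
  exact absurd hn (not_lt.2 h1)

/-- A separated set has arbitrarily large balls with comparatively few points near the boundary. -/
theorem exists_radii (hδ : 0 < δ) (hsep : ∀ s ∈ Λ, ∀ t ∈ Λ, s ≠ t → δ ≤ ‖s - t‖)
    (hne : Λ.Nonempty) :
    ∃ (r : ℕ → ℝ) (S T : ℕ → Finset (Rd d)), ∀ n : ℕ, n ≤ r n ∧ Λ ∩ Metric.ball 0 (r n) = S n ∧
      (S n).Nonempty ∧ T n ⊆ S n ∧ (∀ t ∈ T n, ∀ s ∈ Λ, s ∉ S n → (n : ℝ) ≤ ‖s - t‖) ∧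
      (((S n).card - (T n).card : ℕ) : ℝ) ≤ ((n : ℝ) + 2)⁻¹ * (S n).card := by
  let F (r : ℝ) : Finset (Rd d) := (finite_inter_ball hδ hsep r).toFinset
  have hF (r : ℝ) : Λ ∩ Metric.ball 0 r = F r := (Set.Finite.coe_toFinset _).symm
  have hFm : Monotone F := fun r r' h => by
    rw [← Finset.coe_subset, ← hF, ← hF]
    exact Set.inter_subset_inter_right _ (Metric.ball_subset_ball h)
  have hmem {r : ℝ} {s : Rd d} : s ∈ F r ↔ s ∈ Λ ∧ ‖s‖ < r := by
    rw [← Finset.mem_coe, ← hF, Set.mem_inter_iff, mem_ball_zero_iff]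
  obtain ⟨a, ha⟩ := hne
  have haF : a ∈ F (‖a‖ + 1) := hmem.2 ⟨ha, lt_add_one _⟩
  have hNm : Monotone fun r => ((F r).card : ℝ) := fun r r' h =>
    Nat.cast_le.2 (Finset.card_le_card (hFm h))
  have hv : 0 < volume.real (Metric.ball (0 : Rd d) (δ / 2)) :=
    ENNReal.toReal_pos (Metric.measure_ball_pos volume _ (half_pos hδ)).ne' measure_ball_lt_top.ne
  have hpoly (r : ℝ) (hr : ‖a‖ + 1 ≤ r) : ((F r).card : ℝ) ≤
      ((1 + δ) ^ d * volume.real (Metric.ball (0 : Rd d) 1) /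
        volume.real (Metric.ball (0 : Rd d) (δ / 2))) * (r + 1) ^ d := by
    have hr0 : 0 ≤ r := by linarith [norm_nonneg a]
    have h1 := card_mul_volume_ball_le (S := F r) (δ := δ) (r := r)
      (fun s hs t ht => hsep s (hmem.1 hs).1 t (hmem.1 ht).1)
      (fun s hs => mem_ball_zero_iff.2 (hmem.1 hs).2)
    rw [Measure.addHaar_ball_of_pos volume _ (show 0 < r + δ / 2 by linarith),
      finrank_euclideanSpace_fin] at h1
    have h2 := ENNReal.toReal_mono
      (ENNReal.mul_ne_top ENNReal.ofReal_ne_top measure_ball_lt_top.ne) h1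
    rw [ENNReal.toReal_mul, ENNReal.toReal_mul, ENNReal.toReal_ofReal (by positivity),
      ENNReal.toReal_natCast] at h2
    rw [div_mul_eq_mul_div, le_div_iff₀ hv]
    refine h2.trans ?_
    rw [mul_right_comm, ← mul_pow]
    rw [measureReal_def (s := Metric.ball (0 : Rd d) 1)]
    gcongr
    nlinarith
  have hchoose (n : ℕ) : ∃ r : ℝ, (n : ℝ) ≤ r ∧ ‖a‖ + 1 ≤ r ∧
      -- The boundary layer has width n and relative size 1 / (n + 2); the shift by 2 keeps this
      -- ratio below 1 even at n = 0.
      ((F r).card : ℝ) - (F (r - n)).card ≤ ((n : ℝ) + 2)⁻¹ * (F r).card :=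
    exists_radius_of_polynomial_growth hNm hpoly
      (by exact_mod_cast Finset.card_pos.2 ⟨a, haF⟩) (by positivity) (by positivity)
      (inv_lt_one_of_one_lt₀ (by linarith [Nat.cast_nonneg (α := ℝ) n])) (Nat.cast_nonneg n) n
  choose r hr1 hr2 hr3 using hchoose
  have hsub (n : ℕ) : F (r n - n) ⊆ F (r n) := hFm (by simp)
  refine ⟨r, fun n => F (r n), fun n => F (r n - n), fun n => ⟨hr1 n, hF _,
    ⟨a, hFm (hr2 n) haF⟩, hsub n, fun t ht s hs hsn => ?_, ?_⟩⟩
  · have h1 := (hmem.1 ht).2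
    have h2 : r n ≤ ‖s‖ := not_lt.1 fun h => hsn (hmem.2 ⟨hs, h⟩)
    linarith [norm_sub_norm_le s t]
  · rw [Nat.cast_sub (Finset.card_le_card (hsub n))]
    exact hr3 n

end Radii

/-! ### Properties inherited by vague limits. -/

section Limits

variable {d : ℕ}

theorem translationBounded_of_tendsto {μ : ℕ → Measure (Rd d)} [∀ n, SFinite (μ n)]
    {μ' : Measure (Rd d)} [IsLocallyFiniteMeasure μ'] {A : Set (Rd d)} (hA : MeasurableSet A)
    (hA0 : volume A ≠ 0) {R : ℝ} (hAR : A ⊆ Metric.closedBall 0 R) {C : ℝ≥0∞} (hC : C ≠ ∞)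
    (hμ : ∀ n y, μ n ((fun x => x - y) ⁻¹' A) ≤ C)
    (h : ∀ f : Rd d → ℝ, Continuous f → HasCompactSupport f →
        Tendsto (fun n => ∫ x, f x ∂(μ n)) atTop (𝓝 (∫ x, f x ∂μ'))) :
    TranslationBounded μ' := by
  intro r
  have hAtop : volume A ≠ ∞ := ((Metric.isBounded_closedBall.subset hAR).measure_lt_top).ne
  have hK : C * volume (Metric.ball (0 : Rd d) (r + R)) / volume A ≠ ∞ :=
    ENNReal.div_ne_top (ENNReal.mul_ne_top hC measure_ball_lt_top.ne) hA0
  refine (iSup_le fun x => ?_).trans_lt hK.lt_top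
  refine measure_le_of_tendsto_integral h Metric.isOpen_ball hK fun n => ?_
  rw [ENNReal.le_div_iff_mul_le (Or.inl hA0) (Or.inl hAtop), mul_comm]
  exact measure_mul_ball_le volume hA hAR hC (hμ n) x r

theorem restrict_eq_smul_dirac {μ : Measure (Rd d)} {U : Set (Rd d)} (h0 : 0 ∈ U)
    (h : μ (U \ {0}) = 0) : μ.restrict U = μ {0} • Measure.dirac 0 := by
  rw [← Measure.restrict_singleton]
  exact Measure.restrict_congr_set ((ae_le_set.2 h).antisymm
    (ae_le_set.2 (by rw [Set.sdiff_eq_empty.2 (Set.singleton_subset_iff.2 h0), measure_empty])))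

theorem hasFourierTransform_of_tendsto {γ ν : Measure (Rd d)} {S : ℕ → Finset (Rd d)}
    (hγ : Integrable (decay (Rd d)) γ) (hν : Integrable (decay (Rd d)) ν)
    (h1 : ∀ f : Rd d → ℂ, Continuous f → (∃ K, ∀ x, ‖f x‖ ≤ K * decay (Rd d) x) →
        Tendsto (fun n => ∫ x, f x ∂(autoMeasure (S n))) atTop (𝓝 (∫ x, f x ∂γ)))
    (h2 : ∀ f : Rd d → ℂ, Continuous f → (∃ K, ∀ x, ‖f x‖ ≤ K * decay (Rd d) x) →
        Tendsto (fun n => ∫ x, f x ∂(powerMeasure (S n))) atTop (𝓝 (∫ x, f x ∂ν))) :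
    HasFourierTransform γ ν := by
  have : γ.HasTemperateGrowth := ⟨_, hγ⟩
  have : ν.HasTemperateGrowth := ⟨_, hν⟩
  refine ⟨inferInstance, inferInstance, ?_⟩
  ext f
  change ∫ x, (𝓕 f) x ∂γ = ∫ x, f x ∂ν
  refine tendsto_nhds_unique (h1 _ (𝓕 f).continuous (exists_norm_le_mul_decay_schwartz (𝓕 f))) ?_
  simp_rw [integral_fourier_autoMeasure]
  exact h2 _ f.continuous (exists_norm_le_mul_decay_schwartz f)

variable {A : Set (Rd d)} {Λ : Set (Rd d)}

theorem eq_zero_of_ae_cos_eq_one {η : ℝ} (hη : 0 < η) {x : Rd d}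
    (h : ∀ᵐ u ∂volume.restrict (Metric.ball (0 : Rd d) η),
      Real.cos (2 * Real.pi * inner ℝ u x) = 1) : x = 0 := by
  by_contra hx
  have hx0 : 0 < ‖x‖ := norm_pos_iff.2 hx
  have h1 := Measure.eqOn_open_of_ae_eq (f := fun u => Real.cos (2 * Real.pi * inner ℝ u x))
    (g := fun _ => (1 : ℝ)) h Metric.isOpen_ball (by fun_prop) (by fun_prop)
  -- The first bound places εx in the ball; the second gives 0 < 2πε‖x‖² ≤ π, where the cosine
  -- cannot equal 1.
  set ε : ℝ := min (η / (2 * ‖x‖)) (2⁻¹ / ‖x‖ ^ 2) with hε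
  have hε0 : 0 < ε := lt_min (by positivity) (by positivity)
  have h2 : ε • x ∈ Metric.ball (0 : Rd d) η := by
    rw [mem_ball_zero_iff, norm_smul, Real.norm_of_nonneg hε0.le]
    calc ε * ‖x‖ ≤ η / (2 * ‖x‖) * ‖x‖ := by gcongr; exact min_le_left _ _
      _ = η / 2 := by field_simp
      _ < η := half_lt_self hη
  have h3 := h1 h2
  have h4 : ε * ‖x‖ ^ 2 ≤ 2⁻¹ := by
    calc ε * ‖x‖ ^ 2 ≤ 2⁻¹ / ‖x‖ ^ 2 * ‖x‖ ^ 2 := by gcongr; exact min_le_right _ _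
      _ = 2⁻¹ := by field_simp
  have h5 : 0 < ε * ‖x‖ ^ 2 := by positivity
  simp only [real_inner_smul_left, real_inner_self_eq_norm_sq] at h3
  rw [Real.cos_eq_one_iff_of_lt_of_lt (by nlinarith [Real.pi_pos]) (by nlinarith [Real.pi_pos])]
    at h3
  nlinarith [mul_pos Real.pi_pos h5]

/-- If the averaged defect tends to zero, then the limit of the power measures is a multiple of the
unit mass at the origin on the set where the overlap is positive. -/
theorem measure_overlap_of_tendsto (hb : Bornology.IsBounded A) (hA : MeasurableSet A)
    (hpos : 0 < volume A) (hc : Λ.Countable)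
    (hΛ : ∀ u, ∑' s : Λ, ‖expInt A (u + s)‖ₑ ^ 2 = volume A ^ 2)
    (horth : ∀ s ∈ Λ, ∀ t ∈ Λ, s ≠ t → expInt A (s - t) = 0) {S : ℕ → Finset (Rd d)}
    (hS : ∀ n, (S n : Set (Rd d)) ⊆ Λ) (hne : ∀ n, (S n).Nonempty) {ν : Measure (Rd d)} [SFinite ν]
    [IsLocallyFiniteMeasure ν]
    (hν : ∀ f : Rd d → ℝ, Continuous f → HasCompactSupport f →
        Tendsto (fun n => ∫ x, f x ∂(powerMeasure (S n))) atTop (𝓝 (∫ x, f x ∂ν)))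
    {η : ℝ} (hη : 0 < η)
    (hlim : Tendsto (fun n => ∫⁻ u in Metric.ball 0 η, ENNReal.ofReal
        (∫ x, overlap A x * (1 - Real.cos (2 * Real.pi * inner ℝ u x)) ∂(powerMeasure (S n))))
        atTop (𝓝 0)) :
    ν ({x | 0 < overlap A x} \ {0}) = 0 ∧ ν {0} = volume A := by
  have hcont := continuous_overlap hb hA
  have hsupp := hasCompactSupport_overlap hb
  have hc1 (u : Rd d) :
      Continuous fun x => overlap A x * (1 - Real.cos (2 * Real.pi * inner ℝ u x)) := by fun_prop
  have hs1 (u : Rd d) : HasCompactSupport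
      fun x => overlap A x * (1 - Real.cos (2 * Real.pi * inner ℝ u x)) := hsupp.mul_right
  have hnn (u x : Rd d) : 0 ≤ overlap A x * (1 - Real.cos (2 * Real.pi * inner ℝ u x)) :=
    mul_nonneg (overlap_nonneg A x) (sub_nonneg.2 (Real.cos_le_one _))
  have horth' (n : ℕ) : ∀ s ∈ S n, ∀ t ∈ S n, s ≠ t → expInt A (s - t) = 0 :=
    fun s hs t ht => horth s (hS n hs) t (hS n ht)
  have hmeas (n : ℕ) := measurable_ofReal_defect hb hA hc hΛ (horth' n) (hS n)
  have h1 : ∀ᵐ u ∂volume.restrict (Metric.ball (0 : Rd d) η), ∀ᵐ x ∂ν,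
      overlap A x * (1 - Real.cos (2 * Real.pi * inner ℝ u x)) = 0 := by
    -- Fatou in u: the defects converge for every u while their integrals tend to 0, so the limit
    -- defect vanishes for a.e. u in the ball.
    have h2 := lintegral_liminf_le (u := atTop)
      (μ := volume.restrict (Metric.ball (0 : Rd d) η)) hmeas
    rw [hlim.liminf_eq, nonpos_iff_eq_zero, lintegral_eq_zero_iff (.liminf hmeas)] at h2
    filter_upwards [h2] with u hu
    rw [((ENNReal.tendsto_ofReal (hν _ (hc1 u) (hs1 u))).liminf_eq), Pi.zero_apply,
      ENNReal.ofReal_eq_zero] at hu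
    exact (integral_eq_zero_iff_of_nonneg (hnn u)
      ((hc1 u).integrable_of_hasCompactSupport (hs1 u))).1
      (hu.antisymm (integral_nonneg (hnn u)))
  have h3 : ∀ᵐ x ∂ν, overlap A x ≠ 0 → x = 0 := by
    -- Exchanging the quantifiers yields, for ν-a.e. x with positive overlap, cosine equal to 1 for
    -- a.e. small u.
    rw [Measure.ae_ae_comm] at h1
    · filter_upwards [h1] with x hx hx0
      refine eq_zero_of_ae_cos_eq_one hη ?_
      filter_upwards [hx] with u hu
      linarith [(mul_eq_zero.1 hu).resolve_left hx0]
    · refine (isClosed_eq ?_ continuous_const).measurableSet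
      fun_prop
  have h4 : ν ({x | 0 < overlap A x} \ {0}) = 0 :=
    measure_mono_null (fun x hx => by
      simp only [Set.mem_compl_iff, Set.mem_ofPred_eq, not_forall]
      exact ⟨hx.1.ne', hx.2⟩) h3
  refine ⟨h4, ?_⟩
  have hm : 0 < volume.real A := ENNReal.toReal_pos hpos.ne' hb.measure_lt_top.ne
  -- By orthogonality this integral does not depend on n, so its limit is known; only the atom of ν
  -- at 0 can account for it.
  have h5 (n : ℕ) : ∫ x, overlap A x ∂(powerMeasure (S n)) = volume.real A ^ 2 := by
    have h6 := integral_overlap_powerMeasure hb hA (S n) 0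
    have h7 : ∀ t ∈ S n, ∑ s ∈ S n, ‖expInt A (0 + (s - t))‖ ^ 2 = volume.real A ^ 2 := by
      intro t ht
      rw [Finset.sum_eq_single_of_mem t ht fun s hs hst => by
        rw [zero_add, horth' n s hs t ht hst]; simp]
      simp [expInt_zero]
    simp only [expFun_zero_left, mul_one] at h6
    rw [integral_complex_ofReal, Complex.ofReal_inj, Finset.sum_congr rfl h7, Finset.sum_const,
      nsmul_eq_mul, inv_mul_cancel_left₀ (by exact_mod_cast (hne n).card_pos.ne')] at h6
    exact h6
  have h8 : ∫ x, overlap A x ∂ν = volume.real A ^ 2 := by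
    refine tendsto_nhds_unique (hν _ hcont hsupp) ?_
    simp_rw [h5]
    exact tendsto_const_nhds
  have h9 : ∫ x, overlap A x ∂ν = ν.real {0} * volume.real A := by
    rw [← overlap_zero A, ← smul_eq_mul, ← integral_singleton, ← integral_indicator
      (measurableSet_singleton _)]
    refine integral_congr_ae ?_
    filter_upwards [h3] with x hx
    by_cases hx0 : x = 0
    · simp [hx0]
    · simp [hx0, not_imp_comm.1 hx hx0]
  rw [h8, sq] at h9
  have h10 : ν.real {0} = volume.real A := (mul_right_cancel₀ hm.ne' h9).symm
  rwa [measureReal_def, measureReal_def, ENNReal.toReal_eq_toReal_iff'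
    (isCompact_singleton.measure_lt_top).ne hb.measure_lt_top.ne] at h10

end Limits
-- Assembling the autocorrelation and its Fourier transform.
section WeakTiling

variable {d : ℕ} {A : Set (Rd d)} {Λ : Set (Rd d)}

/-- Existence of the autocorrelation for a set `Λ` satisfying orthogonality and Parseval. -/
theorem exists_autocorrelation (hb : Bornology.IsBounded A) (hA : MeasurableSet A)
    (hpos : 0 < volume A) (hc : Λ.Countable)
    (hΛ : ∀ u, ∑' s : Λ, ‖expInt A (u + s)‖ₑ ^ 2 = volume A ^ 2)
    (horth : ∀ s ∈ Λ, ∀ t ∈ Λ, s ≠ t → expInt A (s - t) = 0) :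
    ∃ γ γhat : Measure (Rd d), IsAutocorrelation Λ γ ∧ TranslationBounded γ ∧
      γ.support ⊆ {u | expInt A u = 0} ∪ {0} ∧
      (∃ U : Set (Rd d), IsOpen U ∧ 0 ∈ U ∧ γ.restrict U = (Measure.dirac 0).restrict U) ∧
      HasFourierTransform γ γhat ∧ TranslationBounded γhat ∧
      γhat.restrict {x | 0 < overlap A x} =
        (volume A • Measure.dirac (0 : Rd d)).restrict {x | 0 < overlap A x} := by
  have hne : Λ.Nonempty := by
    by_contra h
    rw [Set.not_nonempty_iff_eq_empty] at h
    subst h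
    have := hΛ 0
    rw [tsum_empty] at this
    exact hpos.ne (pow_eq_zero_iff two_ne_zero |>.1 this.symm).symm
  obtain ⟨δ, hδ, hE⟩ := exists_expInt_ne_zero hb hpos
  have hsep : ∀ s ∈ Λ, ∀ t ∈ Λ, s ≠ t → δ ≤ ‖s - t‖ := fun s hs t ht hst =>
    not_lt.1 fun h => hE _ h (horth s hs t ht hst)
  obtain ⟨r, S, T, hrST⟩ := exists_radii hδ hsep hne
  choose hrn hS hSne hTS hT hcard using hrST
  have hSΛ (n : ℕ) : (S n : Set (Rd d)) ⊆ Λ := by rw [← hS]; exact Set.inter_subset_left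
  have hSsep (n : ℕ) : ∀ s ∈ S n, ∀ t ∈ S n, s ≠ t → δ ≤ ‖s - t‖ :=
    fun s hs t ht => hsep s (hSΛ n hs) t (hSΛ n ht)
  have hSorth (n : ℕ) : ∀ s ∈ S n, ∀ t ∈ S n, s ≠ t → expInt A (s - t) = 0 :=
    fun s hs t ht => horth s (hSΛ n hs) t (hSΛ n ht)
  obtain ⟨R, hR⟩ := hb.subset_closedBall 0
  have hball0 : volume (Metric.ball (0 : Rd d) (δ / 2)) ≠ 0 :=
    (Metric.measure_ball_pos volume _ (half_pos hδ)).ne'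
  have hAtop : volume A ≠ ∞ := hb.measure_lt_top.ne
  obtain ⟨hγi, σ₁, hσ₁, γ, _, _, hγint, hγ⟩ := exists_subseq_tendsto_integral volume
    (fun n => autoMeasure (S n)) measurableSet_ball hball0 Metric.ball_subset_closedBall
    ENNReal.one_ne_top (fun n => autoMeasure_translate_le (hSsep n))
  -- The second subsequence is extracted from the first, so both families converge along σ.
  obtain ⟨hνi, σ₂, hσ₂, ν, _, _, hνint, hν⟩ := exists_subseq_tendsto_integral volume
    (fun n => powerMeasure (S (σ₁ n))) hA hpos.ne' hR hAtop
    (fun n => powerMeasure_translate_le hb hA (hSorth (σ₁ n)))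
  set σ := fun n => σ₁ (σ₂ n) with hσdef
  have hσ : Tendsto σ atTop atTop := (hσ₁.comp hσ₂).tendsto_atTop
  have hγ' : ∀ f : Rd d → ℝ, Continuous f → (∃ K, ∀ x, |f x| ≤ K * decay (Rd d) x) →
      Tendsto (fun n => ∫ x, f x ∂(autoMeasure (S (σ n)))) atTop (𝓝 (∫ x, f x ∂γ)) :=
    fun f hf hK => (hγ f hf hK).comp hσ₂.tendsto_atTop
  have hγc : ∀ f : Rd d → ℝ, Continuous f → HasCompactSupport f →
      Tendsto (fun n => ∫ x, f x ∂(autoMeasure (S (σ n)))) atTop (𝓝 (∫ x, f x ∂γ)) :=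
    fun f hf hfc => hγ' f hf (exists_norm_le_mul_decay hf hfc)
  have hνc : ∀ f : Rd d → ℝ, Continuous f → HasCompactSupport f →
      Tendsto (fun n => ∫ x, f x ∂(powerMeasure (S (σ n)))) atTop (𝓝 (∫ x, f x ∂ν)) :=
    fun f hf hfc => hν f hf (exists_norm_le_mul_decay hf hfc)
  have hdefect : Tendsto (fun n => ∫⁻ u in Metric.ball 0 (δ / 2), ENNReal.ofReal
      (∫ x, overlap A x * (1 - Real.cos (2 * Real.pi * inner ℝ u x)) ∂(powerMeasure (S n))))
      atTop (𝓝 0) := by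
    have h1 := tendsto_lintegral_expInt_tail hb hA (δ / 2)
    have h2 : Tendsto (fun n : ℕ => ENNReal.ofReal (((n : ℝ) + 2)⁻¹) *
        (volume A ^ 2 * volume (Metric.ball (0 : Rd d) (δ / 2)))) atTop (𝓝 0) := by
      have h3 : Tendsto (fun n : ℕ => ENNReal.ofReal (((n : ℝ) + 2)⁻¹)) atTop (𝓝 0) := by
        rw [← ENNReal.ofReal_zero]
        exact ENNReal.tendsto_ofReal (tendsto_inv_atTop_zero.comp
          (tendsto_atTop_add_const_right _ _ tendsto_natCast_atTop_atTop))
      rw [← zero_mul (volume A ^ 2 * volume (Metric.ball (0 : Rd d) (δ / 2)))]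
      exact ENNReal.Tendsto.mul_const h3 (Or.inr
        (ENNReal.mul_ne_top (ENNReal.pow_ne_top hAtop) measure_ball_lt_top.ne))
    have h4 := h1.add h2
    rw [add_zero] at h4
    refine tendsto_of_tendsto_of_tendsto_of_le_of_le tendsto_const_nhds h4 (fun _ => zero_le)
      fun n => ?_
    refine (lintegral_defect_le hb hA hc hΛ (hSorth n) (hSΛ n)
      (by simpa [mul_div_cancel₀] using hsep) (hTS n) (hT n)).trans ?_
    gcongr
    have hcpos : ((S n).card : ℝ≥0∞) ≠ 0 := by exact_mod_cast (hSne n).card_pos.ne'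
    rw [← ENNReal.div_eq_inv_mul, ENNReal.div_le_iff hcpos (ENNReal.natCast_ne_top _),
      ← ENNReal.ofReal_natCast, ← ENNReal.ofReal_natCast, ← ENNReal.ofReal_mul (by positivity)]
    exact ENNReal.ofReal_le_ofReal (hcard n)
  have hγball : γ (Metric.ball 0 δ \ {0}) = 0 := by
    refine nonpos_iff_eq_zero.1 (measure_le_of_tendsto_integral hγc
      (Metric.isOpen_ball.sdiff isClosed_singleton) ENNReal.zero_ne_top fun n => ?_)
    refine (autoMeasure_eq_zero fun s hs t ht h => ?_).le
    have h1 : ‖s - t‖ < δ := by simpa using h.1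
    exact not_le.2 h1 (hSsep _ s hs t ht fun hst => h.2 (by simp [hst]))
  -- A bump equal to 1 at 0 and vanishing off the separation ball has integral exactly 1 against
  -- every approximant.
  have hγ0 : γ {0} = 1 := by
    obtain ⟨f, hf1, hf0, hfc, -⟩ := exists_continuous_one_zero_of_isCompact
      (isCompact_singleton (x := (0 : Rd d))) Metric.isOpen_ball.isClosed_compl
      (Set.disjoint_compl_right_iff_subset.2
        (Set.singleton_subset_iff.2 (Metric.mem_ball_self hδ)))
    have hf00 : f 0 = 1 := hf1 rfl
    have h1 : ∫ x, f x ∂γ = 1 := by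
      refine tendsto_nhds_unique (hγc f f.continuous hfc) ?_
      refine tendsto_const_nhds.congr fun n => ?_
      rw [integral_autoMeasure_eq_apply_zero (hSne _) fun s hs t ht hst => hf0 ?_, hf00]
      simpa using hSsep _ s hs t ht hst
    have h2 : ∫ x, f x ∂γ = γ.real {0} := by
      rw [← mul_one (γ.real {0}), ← hf00, ← smul_eq_mul, ← integral_singleton,
        ← integral_indicator (measurableSet_singleton _)]
      refine integral_congr_ae ?_
      have h3 : ∀ᵐ x ∂γ, x ∉ Metric.ball (0 : Rd d) δ \ {0} := measure_eq_zero_iff_ae_notMem.1 hγball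
      filter_upwards [h3] with x hx
      by_cases hx0 : x = 0
      · simp [hx0]
      · have hxb : x ∈ (Metric.ball (0 : Rd d) δ)ᶜ := fun h => hx ⟨h, hx0⟩
        simp [hx0, hf0 hxb]
    rw [h1, measureReal_def] at h2
    exact (ENNReal.toReal_eq_one_iff _).1 h2.symm
  obtain ⟨hν1, hν0⟩ := measure_overlap_of_tendsto hb hA hpos hc hΛ horth (fun n => hSΛ (σ n))
    (fun n => hSne (σ n)) hνc (half_pos hδ) (hdefect.comp hσ)
  have hdirac {U : Set (Rd d)} (h0 : (0 : Rd d) ∈ U) :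
      (Measure.dirac (0 : Rd d)).restrict U = Measure.dirac 0 := by
    rw [restrict_eq_smul_dirac h0 (by rw [Measure.dirac_apply]; simp)]
    simp
  refine ⟨γ, ν, ⟨fun n => r (σ n), ?_, fun f hf hfc => ?_⟩, ?_, ?_, ?_, ?_, ?_, ?_⟩
  · exact tendsto_atTop_mono (fun n => hrn (σ n)) (tendsto_natCast_atTop_atTop.comp hσ)
  · simp_rw [averagedAutocorrelation_eq (hS _)]
    exact hγc f hf hfc
  · exact translationBounded_of_tendsto measurableSet_ball hball0 Metric.ball_subset_closedBall
      ENNReal.one_ne_top (fun n => autoMeasure_translate_le (hSsep (σ n))) hγc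
  · have hcl : IsClosed ({u | expInt A u = 0} ∪ {0}) :=
      (isClosed_eq (continuous_expInt hb) continuous_const).union isClosed_singleton
    refine Measure.support_subset_of_isClosed hcl ?_
    rw [mem_ae_iff]
    refine nonpos_iff_eq_zero.1 (measure_le_of_tendsto_integral hγc hcl.isOpen_compl
      ENNReal.zero_ne_top fun n => ?_)
    refine (autoMeasure_eq_zero fun s hs t ht => Set.notMem_compl_iff.2 ?_).le
    by_cases hst : s = t
    · right; simp [hst]
    · left; exact hSorth _ s hs t ht hst
  · refine ⟨Metric.ball 0 δ, Metric.isOpen_ball, Metric.mem_ball_self hδ, ?_⟩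
    rw [restrict_eq_smul_dirac (Metric.mem_ball_self hδ) hγball, hγ0, one_smul,
      hdirac (Metric.mem_ball_self hδ)]
  · exact hasFourierTransform_of_tendsto (S := fun n => S (σ n)) hγint hνint
      (fun f hf hK => tendsto_integral_of_norm_le_decay (fun n => hγi (σ n)) hγint hγ' hf hK)
      (fun f hf hK => tendsto_integral_of_norm_le_decay (fun n => hνi (σ₂ n)) hνint hν hf hK)
  · exact translationBounded_of_tendsto hA hpos.ne' hR hAtop
      (fun n => powerMeasure_translate_le hb hA (hSorth (σ n))) hνc
  · have h0 : (0 : Rd d) ∈ {x | 0 < overlap A x} := by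
      rw [Set.mem_ofPred_eq, overlap_zero]
      exact ENNReal.toReal_pos hpos.ne' hAtop
    rw [restrict_eq_smul_dirac h0 hν1, hν0, Measure.restrict_smul, hdirac h0]

/-- The sign change between the two transforms is harmless because |`expInt`| is even. -/
theorem zeroSet_eq {Ω : Set (Rd d)} (hm : NullMeasurableSet Ω volume) :
    zeroSet Ω = {u | expInt Ω u = 0} := by
  ext u
  rw [zeroSet, Set.mem_ofPred_eq, Set.mem_ofPred_eq, fourier_indicator hm, ← norm_eq_zero,
    norm_expInt_neg, norm_eq_zero]

theorem Delta_eq {Ω : Set (Rd d)} (hb : Bornology.IsBounded Ω) (hAΩ : A =ᵐ[volume] Ω) :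
    Delta Ω = {x | 0 < overlap A x} := by
  ext x
  have h1 : (fun y => y + x) '' Ω = (fun y => y - x) ⁻¹' Ω := by
    simp only [sub_eq_add_neg, ← Set.image_add_right]
  have h2 : (fun y => y - x) ⁻¹' A =ᵐ[volume] (fun y => y - x) ⁻¹' Ω :=
    (measurePreserving_sub_right volume x).quasiMeasurePreserving.preimage_ae_eq hAΩ
  rw [Delta, Set.mem_ofPred_eq, Set.mem_ofPred_eq, h1, overlap, measureReal_def,
    measure_congr (hAΩ.inter h2), ENNReal.toReal_pos_iff]
  exact ⟨fun h => ⟨h, (hb.subset Set.inter_subset_left).measure_lt_top⟩, fun h => h.1⟩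

end WeakTiling
end Fuglede

/-- A spectral set has a weak tiling measure: the Fourier transform of an autocorrelation of one of
its spectra. -/
theorem theorem3p1 (d : ℕ) (Ω : Set (Fuglede.Rd d)) (hb : Bornology.IsBounded Ω)
    (hm : NullMeasurableSet Ω volume) (hpos : 0 < volume Ω) (hs : Fuglede.IsSpectral hb) :
    ∃ γ : Measure (Fuglede.Rd d),
      (∃ Λ : Set (Fuglede.Rd d), Fuglede.IsSpectrum hb Λ ∧ Fuglede.IsAutocorrelation Λ γ) ∧
      Fuglede.TranslationBounded γ ∧
      γ.support ⊆ Fuglede.zeroSet Ω ∪ {0} ∧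
      (∃ U : Set (Fuglede.Rd d), IsOpen U ∧ 0 ∈ U ∧
        γ.restrict U = (Measure.dirac 0).restrict U) ∧
      ∃ γhat : Measure (Fuglede.Rd d),
        Fuglede.HasFourierTransform γ γhat ∧
        Fuglede.TranslationBounded γhat ∧
        γhat.restrict (Fuglede.Delta Ω) =
          (volume Ω • Measure.dirac (0 : Fuglede.Rd d)).restrict (Fuglede.Delta Ω) := by
  obtain ⟨Λ, hΛ⟩ := hs
  -- The analysis is carried out on a Borel subset of full measure; all the quantities involved are
  -- unaffected by null sets.
  obtain ⟨A, hAΩ, hA, hAe⟩ := hm.exists_measurable_subset_ae_eq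
  have hexp : Fuglede.expInt A = Fuglede.expInt Ω := Fuglede.expInt_congr hAe
  have hvol : volume A = volume Ω := measure_congr hAe
  obtain ⟨γ, γhat, h1, h2, h3, h4, h5, h6, h7⟩ := Fuglede.exists_autocorrelation (A := A) (Λ := Λ)
    (hb.subset hAΩ) hA (hvol ▸ hpos) hΛ.countable
    (fun u => by rw [hexp, hvol]; exact hΛ.tsum_expInt hpos u)
    (fun s hs t ht hst => by rw [hexp]; exact hΛ.expInt_sub_eq_zero hs ht hst)
  rw [hexp, ← Fuglede.zeroSet_eq hm] at h3
  rw [← Fuglede.Delta_eq hb hAe, hvol] at h7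
  exact ⟨γ, ⟨Λ, hΛ, h1⟩, h2, h3, h4, γhat, h5, h6, h7⟩
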